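/- All graphs are finite, undirected and simple. A set $S\subseteq V(G)$ is a total dominating set of $G$ if every vertex of $G$ is adjacent to a vertex of $S$; $\gamma_t(G)$ is the minimum cardinality of such a set. A graph $G$ is $k$-$\gamma_t$-vertex-critical if $\gamma_t(G)=k$ and $\gamma_t(G-v)<\gamma_t(G)$ for every vertex $v$ that is not adjacent to a vertex of degree one (in particular, $G-v$ then has a total dominating set). A pointed graph is a graph with two marked vertices, Left and Right; for pointed graphs $G_1,G_2$, the pointed graph $G_1\bullet G_2$ is obtained by identifying the Right vertex of $G_1$ with the Left vertex of $G_2$, its marked vertices being the Left vertex of $G_1$ and the Right vertex of $G_2$. Let $m\ge 2$. Let $K_{m,m}$ be the complete bipartite graph with parts $\{y_1,y_3,\dots,y_{2m-1}\}$ and $\{y_2,y_4,\dots,y_{2m}\}$, let $F=K_{m,m}-y_1y_{2m}$, and let $\overline F$ be the complement of $F$, taken on the vertices $x_1,\dots,x_{2m}$ with $x_i$ corresponding to $y_i$. The pointed graph $R$ is obtained from the disjoint union of $\overline F$ and $K_{m,m}$ by joining $x_i$ to $y_j$ for all $i\ne j$ and adding five new vertices $z_1,z_2,z_3$, Left, Right,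 where Left is adjacent to all $x_i$; $z_1$ is adjacent to $x_1,\dots,x_{2m-1},y_2,\dots,y_{2m-1}$; $z_2$ is adjacent to $x_2,\dots,x_{2m},y_2,\dots,y_{2m-1}$; $z_3$ is adjacent to all $y_i$ and to $z_1$; and Right is adjacent to all $y_i$ and to $z_2$. Let $H$ be a graph on $t\ge 4$ vertices with $\gamma_t(H)=\gamma_t(\overline H)=2$. The pointed graph $A$ is obtained from the disjoint union of $H$ (on $x_1,\dots,x_t$) and $\overline H$ (on $y_1,\dots,y_t$, with $x_i$ corresponding to $y_i$) by joining $x_i$ to $y_j$ for all $i\neq j$ and adding a vertex Left adjacent to all $x_i$ and a vertex Right adjacent to all $y_i$. The pointed graph $Q$ is obtained from two disjoint copies $A_1,A_2$ of $A$ by deleting the Right vertex of $A_1$ and the Left vertex of $A_2$ and joining every neighbour of the former (in $A_1$) to every neighbour of the latter (in $A_2$); its marked vertices are the Left vertex of $A_1$ and the Right vertex of $A_2$. Let $Q^{(0)}$ be a single vertex (both Left and Right), $Q^{(1)}=Q$, and $Q^{(n)}=Q^{(n-1)}\bullet Q$ for $n\ge 2$. Theorem. For all such $m$ and $H$ and every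 integer $n\ge 0$, the graph $R\bullet Q^{(n)}\bullet R\bullet R$ is $(3n+7)$-$\gamma_t$-vertex-critical and has diameter $5n+9$. -/

import Mathlib

universe u

namespace TotalDomination

/-- `S` is a total dominating set of `G`: every vertex has a neighbour in `S`. -/
def IsTotalDominating {V : Type u} (G : SimpleGraph V) (S : Set V) : Prop :=
  ∀ v, ∃ w ∈ S, G.Adj v w

/-- The total domination number: the minimum cardinality of a total dominating set.
It is `⊤` when there is no total dominating set (that is, if some vertex is isolated). -/
noncomputable def totalDominationNumber {V : Type u} (G : SimpleGraph V) : ℕ∞ :=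
  ⨅ S : {S : Set V // IsTotalDominating G S}, S.1.encard

/-- The graph `G - v`. -/
abbrev removeVertex {V : Type u} (G : SimpleGraph V) (v : V) :
    SimpleGraph ({v}ᶜ : Set V) :=
  G.induce {v}ᶜ

/-- `G` is total domination vertex critical: removing any vertex that is not adjacent to a
vertex of degree one decreases the total domination number. -/
def IsVertexCritical {V : Type u} (G : SimpleGraph V) : Prop :=
  ∀ v, (¬ ∃ w, G.Adj v w ∧ (G.neighborSet w).encard = 1) →
    totalDominationNumber (removeVertex G v) < totalDominationNumber G

/-- `G` is `k`-`γ_t`-vertex-critical. -/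
def IsKVertexCritical {V : Type u} (G : SimpleGraph V) (k : ℕ) : Prop :=
  IsVertexCritical G ∧ totalDominationNumber G = k

/-- A graph with two marked vertices `left` and `right`. (In all graphs built below these two
vertices are at distance equal to the diameter; the constructions do not use this.) -/
structure PointedGraph where
  V : Type u
  graph : SimpleGraph V
  left : V
  right : V

namespace PointedGraph

/-- Adjacency of `G₁ • G₂`. The identified vertex is represented by `inl G₁.right`. -/
def dotAdj (G₁ G₂ : PointedGraph.{u}) :
    G₁.V ⊕ {v : G₂.V // v ≠ G₂.left} → G₁.V ⊕ {v : G₂.V // v ≠ G₂.left} → Prop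
  | .inl a, .inl b => G₁.graph.Adj a b
  | .inr a, .inr b => G₂.graph.Adj a.1 b.1
  | .inl a, .inr b => a = G₁.right ∧ G₂.graph.Adj G₂.left b.1
  | .inr a, .inl b => b = G₁.right ∧ G₂.graph.Adj G₂.left a.1

open Classical in
/-- `G₁ • G₂`: identify the `right` vertex of `G₁` with the `left` vertex of `G₂`; the marked
vertices are then the `left` vertex of `G₁` and the `right` vertex of `G₂`. -/
noncomputable def dot (G₁ G₂ : PointedGraph.{u}) : PointedGraph.{u} where
  V := G₁.V ⊕ {v : G₂.V // v ≠ G₂.left}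
  graph :=
    { Adj := dotAdj G₁ G₂
      symm := ⟨by
        rintro (a | a) (b | b) h
        · exact G₁.graph.adj_symm h
        · exact h
        · exact h
        · exact G₂.graph.adj_symm h⟩
      loopless := ⟨by
        rintro (a | a) h
        · exact G₁.graph.irrefl h
        · exact G₂.graph.irrefl h⟩ }
  left := .inl G₁.left
  right := if h : G₂.right = G₂.left then .inl G₁.right else .inr ⟨G₂.right, h⟩

/-- The one-vertex graph, a neutral element for `•` up to isomorphism. -/
def point : PointedGraph.{u} where
  V := PUnit
  graph := ⊥
  left := PUnit.unit
  right := PUnit.unit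

/-- `G^(0)` is a single vertex, `G^(1) = G`, and `G^(n) = G^(n-1) • G` for `n ≥ 2`. -/
noncomputable def dotPow (G : PointedGraph.{u}) : ℕ → PointedGraph.{u}
  | 0 => point
  | 1 => G
  | n + 2 => (dotPow G (n + 1)).dot G

end PointedGraph

/-! ### The graph `R`, with parameter `m`

The index `i : Fin (2 * m)` stands for the subscript `i + 1`, which runs from `1` to `2m`. -/

/-- `K_{m,m}` on `y_1, …, y_{2m}`, with parts the odd and the even subscripts. -/
def graphK (m : ℕ) : SimpleGraph (Fin (2 * m)) where
  Adj i j := i.val % 2 ≠ j.val % 2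
  symm := ⟨fun _ _ h => h.symm⟩
  loopless := ⟨fun _ h => h rfl⟩

/-- The subscript `1`. -/
def IsFirst {m : ℕ} (i : Fin (2 * m)) : Prop := i.val = 0

/-- The subscript `2m`. -/
def IsLast {m : ℕ} (i : Fin (2 * m)) : Prop := i.val + 1 = 2 * m

/-- `F`: the graph `K_{m,m}` without the edge `y_1 y_{2m}`. -/
def graphF (m : ℕ) : SimpleGraph (Fin (2 * m)) where
  Adj i j := (graphK m).Adj i j ∧ ¬ (IsFirst i ∧ IsLast j) ∧ ¬ (IsLast i ∧ IsFirst j)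
  symm := ⟨fun _ _ h => ⟨h.1.symm, fun k => h.2.2 ⟨k.2, k.1⟩, fun k => h.2.1 ⟨k.2, k.1⟩⟩⟩
  loopless := ⟨fun _ h => (graphK m).irrefl h.1⟩

inductive RVertex (m : ℕ) : Type u
  | left
  | right
  | z₁
  | z₂
  | z₃
  | x (i : Fin (2 * m))
  | y (i : Fin (2 * m))

/-- The edges of `R`, each listed in one direction. -/
def RRel (m : ℕ) : RVertex.{u} m → RVertex.{u} m → Prop
  | .x i, .x j => (graphF m)ᶜ.Adj i j
  | .y i, .y j => (graphK m).Adj i j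
  | .x i, .y j => i ≠ j
  | .left, .x _ => True
  | .z₁, .x i => ¬ IsLast i
  | .z₁, .y i => ¬ IsFirst i ∧ ¬ IsLast i
  | .z₂, .x i => ¬ IsFirst i
  | .z₂, .y i => ¬ IsFirst i ∧ ¬ IsLast i
  | .z₃, .y _ => True
  | .z₃, .z₁ => True
  | .right, .y _ => True
  | .right, .z₂ => True
  | _, _ => False

/-- The pointed graph `R`. -/
def graphR (m : ℕ) : PointedGraph.{u} where
  V := RVertex.{u} m
  graph := SimpleGraph.fromRel (RRel m)
  left := .left
  right := .right

/-! ### The graphs `A` and `Q` built from a graph `H` -/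

inductive AVertex (W : Type u) : Type u
  | left
  | right
  | x (w : W)
  | y (w : W)

/-- The edges of `A`, each listed in one direction: the `x`-vertices carry `H`, the `y`-vertices
carry the complement of `H`. -/
def ARel {W : Type u} (H : SimpleGraph W) : AVertex W → AVertex W → Prop
  | .x i, .x j => H.Adj i j
  | .y i, .y j => Hᶜ.Adj i j
  | .x i, .y j => i ≠ j
  | .left, .x _ => True
  | .right, .y _ => True
  | _, _ => False

/-- The pointed graph `A`. -/
def graphA {W : Type u} (H : SimpleGraph W) : PointedGraph.{u} where
  V := AVertex W
  graph := SimpleGraph.fromRel (ARel H)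
  left := .left
  right := .right

/-- Adjacency of `Q`: two copies of `A`, the first without its `right` vertex and the second
without its `left` vertex, where every neighbour of the deleted `right` vertex is joined to
every neighbour of the deleted `left` vertex. -/
def QAdj {W : Type u} (H : SimpleGraph W) :
    {v : AVertex W // v ≠ .right} ⊕ {v : AVertex W // v ≠ .left} →
    {v : AVertex W // v ≠ .right} ⊕ {v : AVertex W // v ≠ .left} → Prop
  | .inl a, .inl b => (graphA H).graph.Adj a.1 b.1
  | .inr a, .inr b => (graphA H).graph.Adj a.1 b.1
  | .inl a, .inr b => (graphA H).graph.Adj .right a.1 ∧ (graphA H).graph.Adj .left b.1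
  | .inr a, .inl b => (graphA H).graph.Adj .right b.1 ∧ (graphA H).graph.Adj .left a.1

/-- The pointed graph `Q`. -/
def graphQ {W : Type u} (H : SimpleGraph W) : PointedGraph.{u} where
  V := {v : AVertex W // v ≠ .right} ⊕ {v : AVertex W // v ≠ .left}
  graph :=
    { Adj := QAdj H
      symm := ⟨by
        rintro (a | a) (b | b) h
        · exact (graphA H).graph.adj_symm h
        · exact h
        · exact h
        · exact (graphA H).graph.adj_symm h⟩
      loopless := ⟨by
        rintro (a | a) h
        · exact (graphA H).graph.irrefl h
        · exact (graphA H).graph.irrefl h⟩ }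
  left := .inl ⟨.left, nofun⟩
  right := .inr ⟨.right, nofun⟩

/-- The pointed graph `R • Q^(n) • R • R`. -/
noncomputable def graphRQRR {W : Type u} (H : SimpleGraph W) (m n : ℕ) : PointedGraph.{u} :=
  (((graphR m).dot ((graphQ H).dotPow n)).dot (graphR m)).dot (graphR m)

end TotalDomination

/-! The vertex shared by two blocks of `X • Y` is a cut vertex, so the theorem reduces to bounds on
single blocks that add up along `•`. The difficulty is that the shared vertex may be dominated from
either side and may itself belong to the set.

Lower bound: `LowerBound X j` records with two 0/1 terms what a block supplies at its right end and
what it demands at its left end. A shared vertex outside the set that is not dominated from the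
right block must be dominated from the left block. The supply therefore covers the demand, and the
inequalities telescope (`LowerBound.dot`). Over the whole graph they give γ_t ≥ j + 1.

Upper bound: `UpperBound` provides sets of size j that spare a prescribed vertex, and sets of size j
+ 1 through a prescribed marked vertex. A set avoiding the shared vertex is continued by one of size
k; a set containing it is continued by one of size k + 1, with one element in common. Both
continuations cost k (`UpperBound.dot`). Hence γ_t ≤ j + 1, and γ_t(G - v) ≤ j for every v
(`isKVertexCritical_of_bounds`).

The blocks R, Q and the point have j = 2, 3 and 0, so the whole graph has j = 2 + 3n + 2 + 2. The
small sets for Q may contain a marked vertex without dominating it; the adjacent block makes up for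
this, and the outer blocks R need no such exemption. For the diameter, walk bounds and level
functions add up in the same way, with 3 for R and 5 for Q. -/

namespace TotalDomination

/-- The vertex `w` has a neighbour in `S`. -/
def Dominates {V : Type u} (G : SimpleGraph V) (S : Set V) (w : V) : Prop :=
  ∃ u ∈ S, G.Adj w u

namespace PointedGraph

variable {X Y : PointedGraph.{u}}

/-! ### The vertices of `X • Y` -/

/-- The vertex of `X • Y` given by a vertex of `X`. -/
def ofLeft (X Y : PointedGraph.{u}) (a : X.V) : (X.dot Y).V := Sum.inl a

open Classical in
/-- The vertex of `X • Y` given by a vertex of `Y`. -/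
noncomputable def ofRight (X Y : PointedGraph.{u}) (b : Y.V) : (X.dot Y).V :=
  if h : b = Y.left then Sum.inl X.right else Sum.inr ⟨b, h⟩

lemma dot_left : (X.dot Y).left = ofLeft X Y X.left := rfl

lemma dot_right : (X.dot Y).right = ofRight X Y Y.right := rfl

lemma ofRight_left : ofRight X Y Y.left = ofLeft X Y X.right := dif_pos rfl

lemma ofRight_of_ne {b : Y.V} (h : b ≠ Y.left) : ofRight X Y b = Sum.inr ⟨b, h⟩ :=
  dif_neg h

lemma ofLeft_injective : Function.Injective (ofLeft X Y) := Sum.inl_injective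

lemma ofLeft_eq_ofRight_iff {a : X.V} {b : Y.V} :
    ofLeft X Y a = ofRight X Y b ↔ a = X.right ∧ b = Y.left := by
  by_cases h : b = Y.left
  · subst h
    simp [ofRight_left, ofLeft_injective.eq_iff]
  · simp only [ofRight_of_ne h, h, and_false, iff_false]
    exact Sum.inl_ne_inr

lemma ofRight_injective : Function.Injective (ofRight X Y) := by
  intro a b h
  by_cases ha : a = Y.left
  · subst ha
    rw [ofRight_left, ofLeft_eq_ofRight_iff] at h
    exact h.2.symm
  by_cases hb : b = Y.left
  · subst hb
    rw [ofRight_left, eq_comm, ofLeft_eq_ofRight_iff] at h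
    exact h.2
  rw [ofRight_of_ne ha, ofRight_of_ne hb] at h
  exact congrArg Subtype.val (Sum.inr_injective h)

lemma dot_cases {P : (X.dot Y).V → Prop} (hl : ∀ a, P (ofLeft X Y a))
    (hr : ∀ b, b ≠ Y.left → P (ofRight X Y b)) (p : (X.dot Y).V) : P p := by
  rcases p with a | ⟨b, hb⟩
  · exact hl a
  · exact ofRight_of_ne hb ▸ hr b hb

lemma adj_ofLeft_ofLeft {a b : X.V} :
    (X.dot Y).graph.Adj (ofLeft X Y a) (ofLeft X Y b) ↔ X.graph.Adj a b := Iff.rfl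

lemma adj_ofRight_ofRight {a b : Y.V} :
    (X.dot Y).graph.Adj (ofRight X Y a) (ofRight X Y b) ↔ Y.graph.Adj a b := by
  by_cases ha : a = Y.left <;> by_cases hb : b = Y.left
  · subst ha hb
    simp
  · subst ha
    rw [ofRight_left, ofRight_of_ne hb]
    exact ⟨fun h => h.2, fun h => ⟨rfl, h⟩⟩
  · subst hb
    rw [ofRight_left, ofRight_of_ne ha]
    exact ⟨fun h => h.2.symm, fun h => ⟨rfl, h.symm⟩⟩
  · rw [ofRight_of_ne ha, ofRight_of_ne hb]
    exact Iff.rfl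

lemma adj_ofLeft_ofRight {a : X.V} {b : Y.V} (hb : b ≠ Y.left) :
    (X.dot Y).graph.Adj (ofLeft X Y a) (ofRight X Y b) ↔
      a = X.right ∧ Y.graph.Adj Y.left b := by
  rw [ofRight_of_ne hb]
  exact Iff.rfl

/-! ### Domination in `X • Y` -/

lemma Dominates.ofLeft {S : Set (X.dot Y).V} {a : X.V}
    (h : Dominates X.graph (PointedGraph.ofLeft X Y ⁻¹' S) a) :
    Dominates (X.dot Y).graph S (PointedGraph.ofLeft X Y a) :=
  let ⟨u, hu, hau⟩ := h
  ⟨PointedGraph.ofLeft X Y u, hu, hau⟩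

lemma Dominates.ofRight {S : Set (X.dot Y).V} {b : Y.V}
    (h : Dominates Y.graph (PointedGraph.ofRight X Y ⁻¹' S) b) :
    Dominates (X.dot Y).graph S (PointedGraph.ofRight X Y b) :=
  let ⟨u, hu, hbu⟩ := h
  ⟨PointedGraph.ofRight X Y u, hu, adj_ofRight_ofRight.2 hbu⟩

/-- Only the shared vertex has neighbours on both sides, hence the second alternative. It is
represented on the left, so the statement for `ofRight` excludes it and has no such alternative. -/
lemma dominates_ofLeft {S : Set (X.dot Y).V} {a : X.V}
    (h : Dominates (X.dot Y).graph S (ofLeft X Y a)) :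
    Dominates X.graph (ofLeft X Y ⁻¹' S) a ∨
      a = X.right ∧ Dominates Y.graph (ofRight X Y ⁻¹' S) Y.left := by
  obtain ⟨u, hu, hau⟩ := h
  induction u using dot_cases with
  | hl u => exact .inl ⟨u, hu, hau⟩
  | hr u hne =>
    rw [adj_ofLeft_ofRight hne] at hau
    exact .inr ⟨hau.1, u, hu, hau.2⟩

lemma dominates_ofRight {S : Set (X.dot Y).V} {b : Y.V} (hb : b ≠ Y.left)
    (h : Dominates (X.dot Y).graph S (ofRight X Y b)) :
    Dominates Y.graph (ofRight X Y ⁻¹' S) b := by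
  obtain ⟨u, hu, hbu⟩ := h
  induction u using dot_cases with
  | hl u =>
    rw [SimpleGraph.adj_comm, adj_ofLeft_ofRight hb] at hbu
    refine ⟨Y.left, ?_, hbu.2.symm⟩
    rw [Set.mem_preimage, ofRight_left, ← hbu.1]
    exact hu
  | hr u _ => exact ⟨u, hu, adj_ofRight_ofRight.1 hbu⟩

lemma encard_dot (S : Set (X.dot Y).V) :
    S.encard = (ofLeft X Y ⁻¹' S).encard + (ofRight X Y ⁻¹' S \ {Y.left}).encard := by
  have hS : S = ofLeft X Y '' (ofLeft X Y ⁻¹' S) ∪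
      ofRight X Y '' (ofRight X Y ⁻¹' S \ {Y.left}) := by
    apply Set.Subset.antisymm
    · intro p hp
      induction p using dot_cases with
      | hl a => exact .inl ⟨a, hp, rfl⟩
      | hr b hb => exact .inr ⟨b, ⟨hp, hb⟩, rfl⟩
    · rintro _ (⟨a, ha, rfl⟩ | ⟨b, hb, rfl⟩)
      · exact ha
      · exact hb.1
  have hdisj : Disjoint (ofLeft X Y '' (ofLeft X Y ⁻¹' S))
      (ofRight X Y '' (ofRight X Y ⁻¹' S \ {Y.left})) := by
    rw [Set.disjoint_left]
    rintro _ ⟨a, -, rfl⟩ ⟨b, hb, hab⟩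
    exact hb.2 (ofLeft_eq_ofRight_iff.1 hab.symm).2
  conv_lhs => rw [hS]
  rw [Set.encard_union_eq hdisj, ofLeft_injective.encard_image, ofRight_injective.encard_image]

/-! ### Lower bounds -/

open Classical in
/-- The indicator of a proposition, with values `0` and `1`. -/
noncomputable def indicator (p : Prop) : ℕ := if p then 1 else 0

lemma indicator_pos {p : Prop} (h : p) : indicator p = 1 := if_pos h

lemma indicator_neg {p : Prop} (h : ¬ p) : indicator p = 0 := if_neg h

lemma indicator_le_one (p : Prop) : indicator p ≤ 1 := by
  unfold indicator
  split_ifs <;> simp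

lemma indicator_mono {p q : Prop} (h : p → q) : indicator p ≤ indicator q := by
  by_cases hp : p
  · rw [indicator_pos hp, indicator_pos (h hp)]
  · simp [indicator_neg hp]

/-- Every set `S` dominating the vertices of `X` other than the marked ones satisfies
`|S \ {left}| ≥ j`, where the bound grows by one if `right` belongs to `S` or is dominated by `S`,
and drops by one if `left` belongs to `S` or is not dominated by `S`. -/
def LowerBound (X : PointedGraph.{u}) (j : ℕ) : Prop :=
  ∀ S : Set X.V, (∀ v, v ≠ X.left → v ≠ X.right → Dominates X.graph S v) →
    (j : ℕ∞) + indicator (X.right ∈ S ∨ Dominates X.graph S X.right) ≤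
      (S \ {X.left}).encard + indicator (X.left ∈ S ∨ ¬ Dominates X.graph S X.left)

/-- Resolves the two indicators into four cases. In the first two bounds the left indicator is 1,
which accounts for `j` becoming `j + 1`; in the last two, `S \ {l}` equals `S`. -/
lemma lowerBound_mk {V : Type u} {G : SimpleGraph V} {l r : V} {j : ℕ}
    (h : ∀ S : Set V, (∀ v, v ≠ l → v ≠ r → Dominates G S v) →
      (j : ℕ∞) ≤ (S \ {l}).encard ∧
      ((r ∈ S ∨ Dominates G S r) → (j : ℕ∞) + 1 ≤ (S \ {l}).encard) ∧
      (l ∉ S → Dominates G S l → (j : ℕ∞) + 1 ≤ S.encard ∧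
        ((r ∈ S ∨ Dominates G S r) → (j : ℕ∞) + 1 + 1 ≤ S.encard))) :
    LowerBound ⟨V, G, l, r⟩ (j + 1) := by
  intro S hS
  obtain ⟨h₁, h₂, h₃⟩ := h S hS
  by_cases hl : l ∈ S ∨ ¬ Dominates G S l
  · rw [indicator_pos hl]
    by_cases hr : r ∈ S ∨ Dominates G S r
    · rw [indicator_pos hr]
      push_cast
      exact add_le_add (h₂ hr) le_rfl
    · rw [indicator_neg hr]
      push_cast
      rw [add_zero]
      exact add_le_add h₁ le_rfl
  · rw [indicator_neg hl]
    push Not at hl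
    obtain ⟨h₃, h₄⟩ := h₃ hl.1 hl.2
    rw [Set.sdiff_singleton_eq_self hl.1, Nat.cast_zero, add_zero]
    by_cases hr : r ∈ S ∨ Dominates G S r
    · rw [indicator_pos hr]
      push_cast
      exact h₄ hr
    · rw [indicator_neg hr]
      push_cast
      rwa [add_zero]

lemma lowerBound_point : LowerBound point.{u} 0 := by
  intro S _
  have : ¬ Dominates point.{u}.graph S point.left := by
    rintro ⟨u, -, hu⟩
    exact hu
  rw [indicator_pos (p := _ ∨ ¬ _) (.inr this), Nat.cast_zero, zero_add]
  exact le_add_left (Nat.cast_le.2 (indicator_le_one _))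

lemma dot_left_ne_right (h : X.left ≠ X.right) : (X.dot Y).left ≠ (X.dot Y).right := by
  rw [dot_left, dot_right, Ne, ofLeft_eq_ofRight_iff]
  exact fun h' => h h'.1

/-- The two inequalities are added. Counting `S \ {left}` in each block counts the shared vertex
exactly once, and the right indicator of `X` cancels the left indicator of `Y`. If the marked
vertices of `Y` coincide, the shared vertex is the right end of the product and need not be
dominated; `k = 0` rescues this case, which occurs for `Q^(0)`. -/
lemma LowerBound.dot {j k : ℕ} (hX : LowerBound X j) (hY : LowerBound Y k)
    (hXne : X.left ≠ X.right) (hYk : Y.right = Y.left → k = 0) :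
    LowerBound (X.dot Y) (j + k) := by
  intro S hS
  have hX' := hX (ofLeft X Y ⁻¹' S) fun v hl hr => by
    refine (dominates_ofLeft (hS (ofLeft X Y v) ?_ ?_)).resolve_right fun h => hr h.1
    · rwa [dot_left, ofLeft_injective.ne_iff]
    · rw [dot_right, Ne, ofLeft_eq_ofRight_iff]
      exact fun h => hr h.1
  have hY' := hY (ofRight X Y ⁻¹' S) fun v hl hr => by
    refine dominates_ofRight hl (hS (ofRight X Y v) ?_ ?_)
    · rw [dot_left, ne_comm, Ne, ofLeft_eq_ofRight_iff]
      exact fun h => hl h.2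
    · rwa [dot_right, ofRight_injective.ne_iff]
  have hcard : (S \ {(X.dot Y).left}).encard = (ofLeft X Y ⁻¹' S \ {X.left}).encard +
      (ofRight X Y ⁻¹' S \ {Y.left}).encard := by
    rw [encard_dot]
    congr 2 <;> ext b
    · simp [dot_left, ofLeft_injective.eq_iff]
    · simp only [Set.mem_sdiff, Set.mem_preimage, Set.mem_singleton_iff, dot_left,
        eq_comm (b := ofLeft X Y X.left), ofLeft_eq_ofRight_iff]
      tauto
  have hneed : Dominates (X.dot Y).graph S (X.dot Y).left →
      Dominates X.graph (ofLeft X Y ⁻¹' S) X.left := fun h =>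
    (dominates_ofLeft h).resolve_right fun h => hXne h.1
  have hcut : X.right ∈ ofLeft X Y ⁻¹' S ↔ Y.left ∈ ofRight X Y ⁻¹' S := by
    rw [Set.mem_preimage, Set.mem_preimage, ofRight_left]
  rw [hcard]
  have hn := indicator_mono (p := X.left ∈ ofLeft X Y ⁻¹' S ∨
      ¬ Dominates X.graph (ofLeft X Y ⁻¹' S) X.left)
    (q := (X.dot Y).left ∈ S ∨ ¬ Dominates (X.dot Y).graph S (X.dot Y).left)
    (Or.imp id fun h h' => h (hneed h'))
  have hright : Dominates (X.dot Y).graph S (ofLeft X Y X.right) →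
      Dominates X.graph (ofLeft X Y ⁻¹' S) X.right ∨
        Dominates Y.graph (ofRight X Y ⁻¹' S) Y.left := fun h =>
    (dominates_ofLeft h).imp_right And.right
  -- The first alternative is the telescoping one. The other two serve a `Y` with coinciding marked
  -- vertices, where the final indicator is paid for by `X` alone or by `Y` alone.
  have key : ∀ {A B : ℕ∞} {a₁ n₁ a₂ n₂ a n : ℕ}, (j : ℕ∞) + a₁ ≤ A + n₁ → (k : ℕ∞) + a₂ ≤ B + n₂ →
      n₁ ≤ n → n₂ ≤ a₁ ∧ a ≤ a₂ ∨ k = 0 ∧ a ≤ a₁ ∨ k = 0 ∧ n₂ = 0 ∧ a ≤ a₂ →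
      ((j + k : ℕ) : ℕ∞) + a ≤ A + B + n := by
    intro A B a₁ n₁ a₂ n₂ a n h₁ h₂ h₃ h₄
    induction A using ENat.recTopCoe with
    | top => simp
    | coe A =>
      induction B using ENat.recTopCoe with
      | top => simp
      | coe B =>
        norm_cast at *
        omega
  refine key hX' hY' hn ?_
  by_cases hYr : Y.right = Y.left
  · rw [dot_right, hYr, ofRight_left]
    by_cases h₁ : X.right ∈ ofLeft X Y ⁻¹' S ∨ Dominates X.graph (ofLeft X Y ⁻¹' S) X.right
    · rw [indicator_pos h₁]
      exact .inr (.inl ⟨hYk hYr, indicator_le_one _⟩)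
    · by_cases h₂ : Dominates Y.graph (ofRight X Y ⁻¹' S) Y.left
      · refine .inr (.inr ⟨hYk hYr, indicator_neg ?_, ?_⟩)
        · rw [← hcut]
          tauto
        · rw [indicator_pos (p := _ ∨ Dominates Y.graph _ _) (.inr h₂)]
          exact indicator_le_one _
      · refine .inr (.inl ⟨hYk hYr, indicator_mono ?_⟩)
        exact Or.imp id fun h => (hright h).resolve_right h₂
  · refine .inl ⟨indicator_mono ?_, indicator_mono ?_⟩
    · rw [← hcut]
      -- The shared vertex is unmarked in the product here, so it must be dominated, from `X` or
      -- from `Y`.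
      have hdom : Dominates (X.dot Y).graph S (ofLeft X Y X.right) := by
        refine hS _ ?_ ?_
        · rw [dot_left, ofLeft_injective.ne_iff]
          exact hXne.symm
        · rw [dot_right, Ne, ofLeft_eq_ofRight_iff]
          exact fun h => hYr h.2
      have := hright hdom
      tauto
    · exact Or.imp id (dominates_ofRight hYr)

/-! ### Upper bounds -/

/-- The vertex `w` is dominated by `S`, or it is a marked vertex that belongs to `S` and is
exempted: the left one if `el`, the right one if `er`. -/
def Covered (X : PointedGraph.{u}) (el er : Prop) (S : Set X.V) (w : X.V) : Prop :=
  Dominates X.graph S w ∨ w ∈ S ∧ (el ∧ w = X.left ∨ er ∧ w = X.right)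

/-- For every vertex `v`, at most `j` vertices other than `v` suffice to cover the vertices other
than `v`; moreover `j + 1` vertices, a given marked vertex among them, suffice to cover everything
without exempting that marked vertex. -/
structure UpperBound (el er : Prop) (X : PointedGraph.{u}) (j : ℕ) : Prop where
  erase : ∀ v, ∃ S : Set X.V, v ∉ S ∧ S.encard ≤ j ∧ ∀ w, w ≠ v → X.Covered el er S w
  left_mem : ∃ S : Set X.V, X.left ∈ S ∧ S.encard ≤ j + 1 ∧ ∀ w, X.Covered False er S w
  right_mem : ∃ S : Set X.V, X.right ∈ S ∧ S.encard ≤ j + 1 ∧ ∀ w, X.Covered el False S w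

lemma upperBound_mk {V : Type u} {G : SimpleGraph V} {l r : V} {el er : Prop} {j : ℕ}
    (erase : ∀ v, ∃ S : Set V, v ∉ S ∧ S.encard ≤ j ∧
      ∀ w, w ≠ v → Dominates G S w ∨ w ∈ S ∧ (el ∧ w = l ∨ er ∧ w = r))
    (left_mem : ∃ S : Set V, l ∈ S ∧ S.encard ≤ j + 1 ∧
      ∀ w, Dominates G S w ∨ w ∈ S ∧ (False ∧ w = l ∨ er ∧ w = r))
    (right_mem : ∃ S : Set V, r ∈ S ∧ S.encard ≤ j + 1 ∧
      ∀ w, Dominates G S w ∨ w ∈ S ∧ (el ∧ w = l ∨ False ∧ w = r)) :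
    UpperBound el er ⟨V, G, l, r⟩ j := ⟨erase, left_mem, right_mem⟩

lemma Covered.mono {el er el' er' : Prop} {S : Set X.V} {w : X.V} (hl : el → el') (hr : er → er')
    (h : X.Covered el er S w) : X.Covered el' er' S w :=
  h.imp_right fun h => h.imp_right fun h => h.imp (fun h => h.imp_left hl) (fun h => h.imp_left hr)

lemma UpperBound.mono {el er el' er' : Prop} {j : ℕ} (h : UpperBound el er X j) (hl : el → el')
    (hr : er → er') : UpperBound el' er' X j where
  erase v := let ⟨S, hv, hS, hc⟩ := h.erase v
    ⟨S, hv, hS, fun w hw => (hc w hw).mono hl hr⟩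
  left_mem := let ⟨S, hv, hS, hc⟩ := h.left_mem
    ⟨S, hv, hS, fun w => (hc w).mono id hr⟩
  right_mem := let ⟨S, hv, hS, hc⟩ := h.right_mem
    ⟨S, hv, hS, fun w => (hc w).mono hl id⟩

lemma upperBound_point : UpperBound True True point.{u} 0 where
  erase v := ⟨∅, by simp, by simp, fun w hw => (hw rfl).elim⟩
  left_mem := ⟨{PUnit.unit}, rfl, (Set.encard_singleton _).le.trans (by simp), fun w => .inr ⟨rfl, .inr ⟨trivial, rfl⟩⟩⟩
  right_mem := ⟨{PUnit.unit}, rfl, (Set.encard_singleton _).le.trans (by simp), fun w => .inr ⟨rfl, .inl ⟨trivial, rfl⟩⟩⟩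

/-- The union of a set of vertices of `X` and a set of vertices of `Y` that agree at the common
vertex. -/
def glue (S : Set X.V) (T : Set Y.V) : Set (X.dot Y).V :=
  {p | Sum.elim (· ∈ S) (fun b => b.1 ∈ T) p}

lemma ofLeft_mem_glue {S : Set X.V} {T : Set Y.V} {a : X.V} :
    ofLeft X Y a ∈ glue S T ↔ a ∈ S := Iff.rfl

lemma ofRight_mem_glue {S : Set X.V} {T : Set Y.V} (h : X.right ∈ S ↔ Y.left ∈ T) {b : Y.V} :
    ofRight X Y b ∈ glue S T ↔ b ∈ T := by
  by_cases hb : b = Y.left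
  · subst hb
    rw [ofRight_left, ofLeft_mem_glue, h]
  · rw [ofRight_of_ne hb]
    exact Iff.rfl

lemma encard_glue {S : Set X.V} {T : Set Y.V} (h : X.right ∈ S ↔ Y.left ∈ T) :
    (glue S T).encard = S.encard + (T \ {Y.left}).encard := by
  have hT : ofRight X Y ⁻¹' glue S T = T := Set.ext fun b => ofRight_mem_glue h
  rw [encard_dot, hT]
  rfl

lemma encard_glue_le {S : Set X.V} {T : Set Y.V} {j k : ℕ} (hX : X.right ∉ S) (hY : Y.left ∉ T)
    (hS : S.encard ≤ j) (hT : T.encard ≤ k) : (glue S T).encard ≤ (j + k : ℕ) := by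
  rw [encard_glue (iff_of_false hX hY), Nat.cast_add]
  exact add_le_add hS ((Set.encard_mono Set.sdiff_subset).trans hT)

lemma encard_glue_le_of_mem {S : Set X.V} {T : Set Y.V} {j k : ℕ} (hX : X.right ∈ S)
    (hY : Y.left ∈ T) (hS : S.encard ≤ j) (hT : T.encard ≤ k + 1) :
    (glue S T).encard ≤ (j + k : ℕ) := by
  rw [encard_glue (iff_of_true hX hY), Nat.cast_add]
  refine add_le_add hS ?_
  rw [← Set.encard_sdiff_singleton_add_one hY] at hT
  exact (ENat.add_le_add_iff_right (by simp)).1 hT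

/-- `D` holds the vertices that need no cover: the deleted vertex, or none. Each side may exempt the
shared vertex, provided that the other side covers it without using that exemption. -/
lemma covered_glue {el er : Prop} {S : Set X.V} {T : Set Y.V} (D : Set (X.dot Y).V)
    (h : X.right ∈ S ↔ Y.left ∈ T)
    (hS : ∀ a, a ≠ X.right → ofLeft X Y a ∉ D → X.Covered el True S a)
    (hT : ∀ b, b ≠ Y.left → ofRight X Y b ∉ D → Y.Covered True er T b)
    (hcut : ofLeft X Y X.right ∉ D → X.Covered el False S X.right ∨ Y.Covered False er T Y.left)
    (w : (X.dot Y).V) (hw : w ∉ D) : (X.dot Y).Covered el er (glue S T) w := by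
  have hpT : ofRight X Y ⁻¹' glue S T = T := Set.ext fun b => ofRight_mem_glue h
  have hL : ∀ a, X.Covered el False S a →
      (X.dot Y).Covered el er (glue S T) (ofLeft X Y a) := by
    rintro a (hd | ⟨ha, ⟨he, rfl⟩ | ⟨⟨⟩, -⟩⟩)
    · exact .inl (Dominates.ofLeft hd)
    · exact .inr ⟨ha, .inl ⟨he, rfl⟩⟩
  have hR : ∀ b, Y.Covered False er T b →
      (X.dot Y).Covered el er (glue S T) (ofRight X Y b) := by
    rintro b (hd | ⟨hb, ⟨⟨⟩, -⟩ | ⟨he, rfl⟩⟩)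
    · exact .inl (Dominates.ofRight (by rwa [hpT]))
    · exact .inr ⟨(ofRight_mem_glue h).2 hb, .inr ⟨he, rfl⟩⟩
  induction w using dot_cases with
  | hl a =>
    by_cases ha : a = X.right
    · subst ha
      rcases hcut hw with hc | hc
      · exact hL _ hc
      · rw [← ofRight_left]
        exact hR _ hc
    · refine hL a ((hS a ha hw).imp_right fun hc => ⟨hc.1, ?_⟩)
      exact .inl (hc.2.resolve_right fun h => ha h.2)
  | hr b hb =>
    refine hR b ((hT b hb hw).imp_right fun hc => ⟨hc.1, ?_⟩)
    exact .inr (hc.2.resolve_left fun h => hb h.2)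

lemma Covered.dominates_of_notMem {el er : Prop} {S : Set X.V} {w : X.V}
    (h : X.Covered el er S w) (hw : w ∉ S) : Dominates X.graph S w :=
  h.resolve_right fun h => hw h.1

/-- If `S` contains the shared vertex, `left_mem` extends it and truly dominates that vertex.
Otherwise `S` already dominates it, since exemption requires membership, and `erase` at `Y.left`
suffices. -/
lemma UpperBound.exists_glue_right {el er : Prop} {i k : ℕ} (hY : UpperBound True er Y k)
    (S : Set X.V) (D : Set (X.dot Y).V) (hS : S.encard ≤ i) (hr : ofLeft X Y X.right ∉ D)
    (hc : ∀ a, ofLeft X Y a ∉ D → X.Covered el True S a) :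
    ∃ T : Set Y.V, (glue S T).encard ≤ (i + k : ℕ) ∧
      ∀ w, w ∉ D → (X.dot Y).Covered el er (glue S T) w := by
  by_cases hrS : X.right ∈ S
  · obtain ⟨T, hlT, hT, hTc⟩ := hY.left_mem
    refine ⟨T, encard_glue_le_of_mem hrS hlT hS hT, covered_glue D (iff_of_true hrS hlT)
      (fun a _ => hc a) (fun b _ _ => (hTc b).mono False.elim id) fun _ => .inr (hTc _)⟩
  · obtain ⟨T, hlT, hT, hTc⟩ := hY.erase Y.left
    exact ⟨T, encard_glue_le hrS hlT hS hT, covered_glue D (iff_of_false hrS hlT)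
      (fun a _ => hc a) (fun b hb _ => hTc b hb)
      fun _ => .inl (.inl ((hc _ hr).dominates_of_notMem hrS))⟩

lemma UpperBound.exists_glue_left {el er : Prop} {i j : ℕ} (hX : UpperBound el True X j)
    (T : Set Y.V) (D : Set (X.dot Y).V) (hT : T.encard ≤ i) (hr : ofRight X Y Y.left ∉ D)
    (hc : ∀ b, ofRight X Y b ∉ D → Y.Covered True er T b) :
    ∃ S : Set X.V, (X.right ∈ S ↔ Y.left ∈ T) ∧ (glue S T).encard ≤ (j + i : ℕ) ∧
      ∀ w, w ∉ D → (X.dot Y).Covered el er (glue S T) w := by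
  by_cases hlT : Y.left ∈ T
  · obtain ⟨S, hrS, hS, hSc⟩ := hX.right_mem
    refine ⟨S, iff_of_true hrS hlT, ?_, covered_glue D (iff_of_true hrS hlT)
      (fun a _ _ => (hSc a).mono id False.elim) (fun b _ => hc b) fun _ => .inl (hSc _)⟩
    rw [encard_glue (iff_of_true hrS hlT), ← ENat.add_le_add_iff_right ENat.one_ne_top, add_assoc,
      Set.encard_sdiff_singleton_add_one hlT]
    refine (add_le_add hS hT).trans ?_
    norm_cast
    omega
  · obtain ⟨S, hrS, hS, hSc⟩ := hX.erase X.right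
    exact ⟨S, iff_of_false hrS hlT, encard_glue_le hrS hlT hS hT,
      covered_glue D (iff_of_false hrS hlT) (fun a ha _ => hSc a ha) (fun b _ => hc b)
      fun _ => .inr (.inl ((hc _ hr).dominates_of_notMem hlT))⟩

lemma UpperBound.dot {el er : Prop} {j k : ℕ} (hX : UpperBound el True X j)
    (hY : UpperBound True er Y k) : UpperBound el er (X.dot Y) (j + k) where
  erase v := by
    induction v using dot_cases with
    | hl v =>
      obtain ⟨S, hv, hS, hc⟩ := hX.erase v
      -- When the shared vertex itself is deleted, neither side contains or covers it, and `erase`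
      -- is used on both sides.
      by_cases hvr : v = X.right
      · subst hvr
        obtain ⟨T, hl, hT, hTc⟩ := hY.erase Y.left
        exact ⟨glue S T, hv, encard_glue_le hv hl hS hT, covered_glue {ofLeft X Y X.right}
          (iff_of_false hv hl) (fun a ha _ => hc a ha) (fun b hb _ => hTc b hb)
          fun h => (h rfl).elim⟩
      · obtain ⟨T, hT, hTc⟩ := hY.exists_glue_right S {ofLeft X Y v} hS
          (fun h => hvr (ofLeft_injective h).symm)
          fun a ha => hc a fun h => ha (congrArg _ h)
        exact ⟨glue S T, hv, hT, hTc⟩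
    | hr v hv =>
      obtain ⟨T, hvT, hT, hc⟩ := hY.erase v
      obtain ⟨S, hcut, hS, hSc⟩ := hX.exists_glue_left T {ofRight X Y v} hT
          (fun h => hv (ofRight_injective h).symm)
          fun a ha => hc a fun h => ha (congrArg _ h)
      exact ⟨glue S T, by rwa [ofRight_mem_glue hcut], hS, hSc⟩
  left_mem := by
    obtain ⟨S, hl, hS, hc⟩ := hX.left_mem
    obtain ⟨T, hT, hTc⟩ := hY.exists_glue_right S ∅ (i := j + 1) hS (Set.notMem_empty _)
      fun a _ => hc a
    refine ⟨glue S T, hl, hT.trans (le_of_eq ?_), fun w => hTc w (Set.notMem_empty _)⟩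
    push_cast
    ring
  right_mem := by
    obtain ⟨T, hr, hT, hc⟩ := hY.right_mem
    obtain ⟨S, hcut, hS, hSc⟩ := hX.exists_glue_left T ∅ (i := k + 1) hT (Set.notMem_empty _)
      fun a _ => hc a
    refine ⟨glue S T, ?_, hS.trans (le_of_eq ?_), fun w => hSc w (Set.notMem_empty _)⟩
    · rwa [dot_right, ofRight_mem_glue hcut]
    · push_cast
      ring

/-! ### Distances -/

/-- Any two vertices of `X` are joined by a walk of length at most `ℓ`. -/
def WalkBound (X : PointedGraph.{u}) (ℓ : ℕ) : Prop :=
  ∀ a b, ∃ p : X.graph.Walk a b, p.length ≤ ℓ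

/-- There is a function with `f left = 0` and `f right = ℓ` that increases by at most one along
every edge. -/
def HasLevels (X : PointedGraph.{u}) (ℓ : ℕ) : Prop :=
  ∃ f : X.V → ℕ, f X.left = 0 ∧ f X.right = ℓ ∧ ∀ a b, X.graph.Adj a b → f b ≤ f a + 1

lemma exists_walk_of_adj {V : Type u} {G : SimpleGraph V} {a b : V} {k : ℕ} (h : G.Adj a b) :
    ∃ p : G.Walk a b, p.length ≤ k + 1 := ⟨h.toWalk, by simp⟩

lemma exists_walk_cons {V : Type u} {G : SimpleGraph V} {a b c : V} {k : ℕ} (h : G.Adj a b)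
    (hp : ∃ p : G.Walk b c, p.length ≤ k) : ∃ p : G.Walk a c, p.length ≤ k + 1 :=
  let ⟨p, hp⟩ := hp
  ⟨p.cons h, by simpa using hp⟩

lemma exists_walk_symm {V : Type u} {G : SimpleGraph V} {a b : V} {k : ℕ}
    (hp : ∃ p : G.Walk a b, p.length ≤ k) : ∃ p : G.Walk b a, p.length ≤ k :=
  let ⟨p, hp⟩ := hp
  ⟨p.reverse, by simpa using hp⟩

lemma exists_walk_append {V : Type u} {G : SimpleGraph V} {a b c : V} {k ℓ n : ℕ}
    (hp : ∃ p : G.Walk a b, p.length ≤ k) (hq : ∃ q : G.Walk b c, q.length ≤ ℓ) (hn : k + ℓ ≤ n) :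
    ∃ p : G.Walk a c, p.length ≤ n :=
  let ⟨p, hp⟩ := hp
  let ⟨q, hq⟩ := hq
  ⟨p.append q, by rw [SimpleGraph.Walk.length_append]; omega⟩

lemma walkBound_point : WalkBound point.{u} 0 := fun _ _ => ⟨.nil, le_rfl⟩

lemma hasLevels_point : HasLevels point.{u} 0 := ⟨fun _ => 0, rfl, rfl, fun _ _ _ => by simp⟩

lemma WalkBound.dot {k ℓ : ℕ} (hX : WalkBound X k) (hY : WalkBound Y ℓ) :
    WalkBound (X.dot Y) (k + ℓ) := by
  let φ : X.graph →g (X.dot Y).graph := ⟨ofLeft X Y, adj_ofLeft_ofLeft.2⟩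
  let ψ : Y.graph →g (X.dot Y).graph := ⟨ofRight X Y, adj_ofRight_ofRight.2⟩
  have hL : ∀ a b, ∃ p : (X.dot Y).graph.Walk (ofLeft X Y a) (ofLeft X Y b), p.length ≤ k :=
    fun a b => let ⟨p, hp⟩ := hX a b
      ⟨p.map φ, by rwa [SimpleGraph.Walk.length_map]⟩
  have hR : ∀ a b, ∃ p : (X.dot Y).graph.Walk (ofRight X Y a) (ofRight X Y b), p.length ≤ ℓ :=
    fun a b => let ⟨p, hp⟩ := hY a b
      ⟨p.map ψ, by rwa [SimpleGraph.Walk.length_map]⟩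
  have hLR : ∀ a b, ∃ p : (X.dot Y).graph.Walk (ofLeft X Y a) (ofRight X Y b),
      p.length ≤ k + ℓ := by
    intro a b
    obtain ⟨p, hp⟩ := hL a X.right
    obtain ⟨q, hq⟩ := hR Y.left b
    refine ⟨p.append (q.copy ofRight_left rfl), ?_⟩
    rw [SimpleGraph.Walk.length_append, SimpleGraph.Walk.length_copy]
    omega
  intro a b
  induction a using dot_cases with
  | hl a =>
    induction b using dot_cases with
    | hl b => exact (hL a b).imp fun p hp => by omega
    | hr b _ => exact hLR a b
  | hr a _ =>
    induction b using dot_cases with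
    | hl b =>
      obtain ⟨p, hp⟩ := hLR b a
      exact ⟨p.reverse, by rwa [SimpleGraph.Walk.length_reverse]⟩
    | hr b _ => exact (hR a b).imp fun p hp => by omega

lemma HasLevels.dot {k ℓ : ℕ} (hX : HasLevels X k) (hY : HasLevels Y ℓ) :
    HasLevels (X.dot Y) (k + ℓ) := by
  obtain ⟨f, hfl, hfr, hf⟩ := hX
  obtain ⟨g, hgl, hgr, hg⟩ := hY
  let h : (X.dot Y).V → ℕ := fun p => Sum.elim f (fun b => k + g b.1) p
  have hL : ∀ a, h (ofLeft X Y a) = f a := fun _ => rfl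
  have hR : ∀ b, h (ofRight X Y b) = k + g b := by
    intro b
    by_cases hb : b = Y.left
    · subst hb
      rw [ofRight_left, hL, hfr, hgl, add_zero]
    · rw [ofRight_of_ne hb]
      rfl
  refine ⟨h, by rw [dot_left, hL, hfl], by rw [dot_right, hR, hgr], fun a b hab => ?_⟩
  induction a using dot_cases with
  | hl a =>
    induction b using dot_cases with
    | hl b => exact hf a b hab
    | hr b hb =>
      rw [adj_ofLeft_ofRight hb] at hab
      have := hg _ _ hab.2
      rw [hL, hR, hab.1, hfr]
      omega
  | hr a ha =>
    induction b using dot_cases with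
    | hl b =>
      rw [SimpleGraph.adj_comm, adj_ofLeft_ofRight ha] at hab
      rw [hL, hR, hab.1, hfr]
      omega
    | hr b _ =>
      have := hg _ _ (adj_ofRight_ofRight.1 hab)
      rw [hR, hR]
      omega

/-- The diameter of `X` is `ℓ`, attained by the marked vertices. -/
lemma diam_eq {ℓ : ℕ} (hw : WalkBound X ℓ) (hl : HasLevels X ℓ) : X.graph.diam = ℓ := by
  obtain ⟨f, hfl, hfr, hf⟩ := hl
  -- Levels rise by at most one per edge, so every walk between the marked vertices has length at
  -- least `ℓ`.
  have hwalk : ∀ {a b : X.V} (p : X.graph.Walk a b), f b ≤ f a + p.length := by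
    intro a b p
    induction p with
    | nil => simp
    | cons h p ih =>
      have := hf _ _ h
      rw [SimpleGraph.Walk.length_cons]
      omega
  have hed : X.graph.ediam ≤ ℓ := SimpleGraph.ediam_le_of_edist_le fun a b => by
    obtain ⟨p, hp⟩ := hw a b
    exact (SimpleGraph.edist_le p).trans (Nat.cast_le.2 hp)
  -- `diam` takes the value 0 when `ediam` is infinite, so finiteness is needed before distances
  -- bound it from below.
  have htop : X.graph.ediam ≠ ⊤ := ne_top_of_le_ne_top (ENat.natCast_ne_top _) hed
  apply le_antisymm
  · exact ENat.toNat_le_of_le_natCast hed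
  · obtain ⟨p, -⟩ := hw X.left X.right
    obtain ⟨q, hq⟩ := SimpleGraph.Reachable.exists_walk_length_eq_dist ⟨p⟩
    have := hwalk q
    rw [hfl, hfr, hq, zero_add] at this
    exact this.trans (SimpleGraph.dist_le_diam htop)

end PointedGraph

/-! ### Total domination -/

open PointedGraph in
-- For a total dominating set the right indicator is 1 and the left one is 1 exactly when `left ∈
-- S`, so the lower bound reads j + 1 ≤ |S|. The sets from `erase` work for every deleted vertex, so
-- the degree-one exception plays no role.
lemma isKVertexCritical_of_bounds {X : PointedGraph.{u}} {j : ℕ} (hl : LowerBound X j)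
    (hu : UpperBound False False X j) : IsKVertexCritical X.graph (j + 1) := by
  have hcov : ∀ {S : Set X.V} {w : X.V}, X.Covered False False S w → Dominates X.graph S w :=
    fun h => h.resolve_right fun h => by simpa using h.2
  have heq : totalDominationNumber X.graph = (j + 1 : ℕ) := by
    apply le_antisymm
    · obtain ⟨S, -, hS, hc⟩ := hu.left_mem
      exact (iInf_le _ (⟨S, fun w => hcov (hc w)⟩ :
        {S : Set X.V // IsTotalDominating X.graph S})).trans hS
    · refine le_iInf fun ⟨S, hS⟩ => ?_
      have h := hl S fun v _ _ => hS v
      rw [indicator_pos (p := X.right ∈ S ∨ Dominates _ _ _) (.inr (hS X.right))] at h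
      push_cast at h ⊢
      refine h.trans ?_
      by_cases hm : X.left ∈ S
      · rw [indicator_pos (.inl hm), Nat.cast_one, Set.encard_sdiff_singleton_add_one hm]
      · rw [indicator_neg fun h => h.elim hm fun h => h (hS X.left), Nat.cast_zero, add_zero]
        exact Set.encard_mono Set.sdiff_subset
  refine ⟨fun v _ => ?_, heq⟩
  obtain ⟨S, hv, hS, hc⟩ := hu.erase v
  rw [heq]
  let T : Set ({v}ᶜ : Set X.V) := Subtype.val ⁻¹' S
  have hT : IsTotalDominating (removeVertex X.graph v) T := by
    rintro ⟨w, hw⟩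
    obtain ⟨u, hu, hwu⟩ := hcov (hc w hw)
    exact ⟨⟨u, fun h => hv (h ▸ hu)⟩, hu, hwu⟩
  have hTS : T.encard ≤ j := by
    rw [← Subtype.val_injective.encard_image]
    exact (Set.encard_mono (Set.image_preimage_subset _ _)).trans hS
  refine ((iInf_le _ (⟨T, hT⟩ : {T // IsTotalDominating (removeVertex X.graph v) T})).trans
    hTS).trans_lt ?_
  exact_mod_cast Nat.lt_succ_self j

open PointedGraph

/-! ### Cardinalities of small sets -/

section Encard

variable {V : Type*} {S : Set V} {a b c : V}

lemma two_le_encard (ha : a ∈ S) (hb : b ∈ S) (hab : a ≠ b) : 2 ≤ S.encard := by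
  rw [← Set.encard_pair hab]
  exact Set.encard_mono (Set.insert_subset ha (Set.singleton_subset_iff.2 hb))

lemma three_le_encard (ha : a ∈ S) (hb : b ∈ S) (hc : c ∈ S) (hab : a ≠ b) (hac : a ≠ c)
    (hbc : b ≠ c) : 3 ≤ S.encard := by
  rw [← Set.encard_eq_three.2 ⟨a, b, c, hab, hac, hbc, rfl⟩]
  exact Set.encard_mono (by simp [Set.insert_subset_iff, *])

lemma eq_of_not_two_le (h : ¬ 2 ≤ S.encard) (ha : a ∈ S) : ∀ u ∈ S, u = a := by
  by_contra! h'
  obtain ⟨u, hu, hne⟩ := h'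
  exact h (two_le_encard hu ha hne)

lemma eq_or_eq_of_not_three_le (h : ¬ 3 ≤ S.encard) (ha : a ∈ S) (hb : b ∈ S) (hab : a ≠ b) :
    ∀ u ∈ S, u = a ∨ u = b := by
  by_contra! h'
  obtain ⟨u, hu, hne, hne'⟩ := h'
  exact h (three_le_encard hu ha hb hne hne' hab)

lemma eq_or_eq_or_eq_of_not_four_le (h : ¬ 4 ≤ S.encard) (ha : a ∈ S) (hb : b ∈ S) (hc : c ∈ S)
    (hab : a ≠ b) (hac : a ≠ c) (hbc : b ≠ c) : ∀ u ∈ S, u = a ∨ u = b ∨ u = c := by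
  by_contra! h'
  obtain ⟨u, hu, hne, hne', hne''⟩ := h'
  have hsub : {u, a, b, c} ⊆ S := by simp [Set.insert_subset_iff, *]
  refine h (le_trans (le_of_eq ?_) (Set.encard_mono hsub))
  rw [Set.encard_insert_of_notMem (by simp [*]), Set.encard_insert_of_notMem (by simp [*]),
    Set.encard_pair hbc]
  norm_num

lemma encard_pair_le (a b : V) : ({a, b} : Set V).encard ≤ 2 :=
  (Set.encard_insert_le _ _).trans (by rw [Set.encard_singleton]; norm_num)

lemma encard_triple_le (a b c : V) : ({a, b, c} : Set V).encard ≤ 3 :=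
  (Set.encard_insert_le _ _).trans ((add_le_add (encard_pair_le b c) le_rfl).trans (by norm_num))

end Encard

lemma dominates_pair {V : Type u} {G : SimpleGraph V} {a b w : V} :
    Dominates G {a, b} w ↔ G.Adj w a ∨ G.Adj w b := by
  simp [Dominates]

lemma dominates_triple {V : Type u} {G : SimpleGraph V} {a b c w : V} :
    Dominates G {a, b, c} w ↔ G.Adj w a ∨ G.Adj w b ∨ G.Adj w c := by
  simp [Dominates]

/-! ### The graph `R` -/

section R

variable {m : ℕ}

/-- The arithmetic description of the adjacency of `R`. -/
def RAdj (m : ℕ) : RVertex.{u} m → RVertex.{u} m → Prop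
  | .x i, .x j => i.val ≠ j.val ∧ (i.val % 2 = j.val % 2 ∨ (i.val = 0 ∧ j.val + 1 = 2 * m) ∨
      (i.val + 1 = 2 * m ∧ j.val = 0))
  | .y i, .y j => i.val % 2 ≠ j.val % 2
  | .x i, .y j => i.val ≠ j.val
  | .y i, .x j => i.val ≠ j.val
  | .left, .x _ => True
  | .x _, .left => True
  | .z₁, .x i => i.val + 1 ≠ 2 * m
  | .x i, .z₁ => i.val + 1 ≠ 2 * m
  | .z₁, .y i => i.val ≠ 0 ∧ i.val + 1 ≠ 2 * m
  | .y i, .z₁ => i.val ≠ 0 ∧ i.val + 1 ≠ 2 * m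
  | .z₂, .x i => i.val ≠ 0
  | .x i, .z₂ => i.val ≠ 0
  | .z₂, .y i => i.val ≠ 0 ∧ i.val + 1 ≠ 2 * m
  | .y i, .z₂ => i.val ≠ 0 ∧ i.val + 1 ≠ 2 * m
  | .z₃, .y _ => True
  | .y _, .z₃ => True
  | .z₃, .z₁ => True
  | .z₁, .z₃ => True
  | .right, .y _ => True
  | .y _, .right => True
  | .right, .z₂ => True
  | .z₂, .right => True
  | _, _ => False

lemma fromRel_RRel_adj {a b : RVertex.{u} m} :
    (SimpleGraph.fromRel (RRel m)).Adj a b ↔ RAdj m a b := by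
  change a ≠ b ∧ (RRel m a b ∨ RRel m b a) ↔ _
  cases a <;> cases b <;>
    simp [RRel, RAdj, graphF, graphK, IsFirst, IsLast, Fin.ext_iff, eq_comm] <;> omega

lemma graphR_left_ne_right : (graphR.{u} m).left ≠ (graphR m).right := nofun

/-- Dominating z₃ costs a vertex z₁ or y_j, dominating Left costs some x_i, and Right active (in `S`
or dominated) requires Right, z₂ or some y_j. Only a y_j can meet the first and third needs at once.
Alone, or with Left, it leaves y_j itself undominated; with x_i it fails at one of y_j, y_i, x_j,
z₁, z₂. -/
lemma lowerBound_graphR : LowerBound (graphR.{u} m) 2 := by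
  refine lowerBound_mk fun S hS => ?_
  replace hS : ∀ v : RVertex.{u} m, v ≠ .left → v ≠ .right → ∃ u ∈ S, RAdj m v u :=
    fun v hl hr => let ⟨u, hu, h⟩ := hS v hl hr
      ⟨u, hu, fromRel_RRel_adj.1 h⟩
  obtain ⟨a, haS, ha⟩ : ∃ a ∈ S, a = RVertex.z₁ ∨ ∃ j, a = RVertex.y j := by
    obtain ⟨u, hu, h⟩ := hS .z₃ nofun nofun
    rcases u with _ | _ | _ | _ | _ | i | i <;> first | exact h.elim | exact ⟨_, hu, by simp⟩
  have hal : a ≠ RVertex.left := by rcases ha with rfl | ⟨j, rfl⟩ <;> exact nofun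
  have hact : RVertex.right ∈ S ∨ Dominates (SimpleGraph.fromRel (RRel m)) S RVertex.right →
      ∃ b ∈ S, b = RVertex.right ∨ b = RVertex.z₂ ∨ ∃ j, b = RVertex.y j := by
    rintro (h | ⟨u, hu, h⟩)
    · exact ⟨_, h, .inl rfl⟩
    rw [fromRel_RRel_adj] at h
    rcases u with _ | _ | _ | _ | _ | i | i <;> first | exact h.elim | exact ⟨_, hu, by simp⟩
  have haT : a ∈ S \ {RVertex.left} := ⟨haS, hal⟩
  refine ⟨?_, fun hr => ?_, fun hl hd => ?_⟩
  · rw [Nat.cast_one, Set.one_le_encard_iff_nonempty]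
    exact ⟨a, haT⟩
  · norm_num
    by_contra hcard
    have heq := eq_of_not_two_le hcard haT
    obtain ⟨b, hbS, hb⟩ := hact hr
    have hba : b = a := heq b ⟨hbS, by rcases hb with rfl | rfl | ⟨j, rfl⟩ <;> exact nofun⟩
    subst hba
    obtain ⟨j, rfl⟩ : ∃ j, b = RVertex.y j := by
      rcases hb with rfl | rfl | ⟨j, rfl⟩
      · simp at ha
      · simp at ha
      · exact ⟨j, rfl⟩
    obtain ⟨u, hu, h⟩ := hS (.y j) nofun nofun
    by_cases hul : u = RVertex.left
    · subst hul
      exact h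
    · have := heq u ⟨hu, hul⟩
      subst this
      exact h rfl
  · obtain ⟨i, hi⟩ : ∃ i, RVertex.x i ∈ S := by
      obtain ⟨u, hu, h⟩ := hd
      rw [fromRel_RRel_adj] at h
      rcases u with _ | _ | _ | _ | _ | i | i <;> first | exact h.elim | exact ⟨_, hu⟩
    have hia : RVertex.x i ≠ a := by rcases ha with rfl | ⟨j, rfl⟩ <;> exact nofun
    norm_num
    refine ⟨two_le_encard hi haS hia, fun hr => ?_⟩
    by_contra hcard
    have heq := eq_or_eq_of_not_three_le hcard hi haS hia
    obtain ⟨b, hbS, hb⟩ := hact hr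
    have hba : b = a :=
      (heq b hbS).resolve_left (by rcases hb with rfl | rfl | ⟨j, rfl⟩ <;> exact nofun)
    subst hba
    obtain ⟨j, rfl⟩ : ∃ j, b = RVertex.y j := by
      rcases hb with rfl | rfl | ⟨j, rfl⟩
      · simp at ha
      · simp at ha
      · exact ⟨j, rfl⟩
    have hdom : ∀ v : RVertex.{u} m, v ≠ .left → v ≠ .right →
        RAdj m v (.x i) ∨ RAdj m v (.y j) := fun v hl hr => by
      obtain ⟨u, hu, h⟩ := hS v hl hr
      rcases heq u hu with rfl | rfl
      · exact .inl h
      · exact .inr h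
    have h₁ := hdom (.y j) nofun nofun
    have h₂ := hdom (.y i) nofun nofun
    have h₃ := hdom (.x j) nofun nofun
    have h₄ := hdom .z₁ nofun nofun
    have h₅ := hdom .z₂ nofun nofun
    simp only [RAdj] at h₁ h₂ h₃ h₄ h₅
    omega

lemma upperBound_graphR (hm : 2 ≤ m) : UpperBound False False (graphR.{u} m) 2 := by
  have pair : ∀ (v a b : RVertex.{u} m), v ≠ a → v ≠ b →
      (∀ w, w ≠ v → RAdj m w a ∨ RAdj m w b) →
      ∃ S : Set (RVertex.{u} m), v ∉ S ∧ S.encard ≤ (2 : ℕ) ∧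
        ∀ w, w ≠ v → Dominates (SimpleGraph.fromRel (RRel m)) S w := fun v a b ha hb h =>
    ⟨{a, b}, by simp [ha, hb], encard_pair_le a b, fun w hw =>
      (dominates_pair.2 (by simpa only [fromRel_RRel_adj] using h w hw))⟩
  have triple : ∀ (a b c : RVertex.{u} m), (∀ w, RAdj m w a ∨ RAdj m w b ∨ RAdj m w c) →
      ∃ S : Set (RVertex.{u} m), a ∈ S ∧ S.encard ≤ (2 : ℕ) + 1 ∧
        ∀ w, Dominates (SimpleGraph.fromRel (RRel m)) S w := fun a b c h =>
    ⟨{a, b, c}, by simp, (encard_triple_le a b c).trans (by norm_num), fun w =>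
      (dominates_triple.2 (by simpa only [fromRel_RRel_adj] using h w))⟩
  have h0 : 0 < 2 * m := by omega
  have h1 : 1 < 2 * m := by omega
  have h2 : 2 < 2 * m := by omega
  have hl : 2 * m - 1 < 2 * m := by omega
  suffices h : (∀ v, ∃ S : Set (RVertex.{u} m), v ∉ S ∧ S.encard ≤ (2 : ℕ) ∧
      ∀ w, w ≠ v → Dominates (SimpleGraph.fromRel (RRel m)) S w) ∧
      (∀ w, RAdj m w RVertex.left ∨ RAdj m w (.x ⟨0, h0⟩) ∨ RAdj m w (.y ⟨1, h1⟩)) ∧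
      (∀ w, RAdj m w RVertex.right ∨ RAdj m w (.x ⟨0, h0⟩) ∨ RAdj m w (.y ⟨2, h2⟩)) by
    obtain ⟨h₁, h₂, h₃⟩ := h
    obtain ⟨S, hS, hS', hS''⟩ := triple _ _ _ h₂
    obtain ⟨T, hT, hT', hT''⟩ := triple _ _ _ h₃
    refine upperBound_mk (fun v => ?_) ⟨S, hS, hS', fun w => .inl (hS'' w)⟩
      ⟨T, hT, hT', fun w => .inl (hT'' w)⟩
    obtain ⟨S, hv, hS, hc⟩ := h₁ v
    exact ⟨S, hv, hS, fun w hw => .inl (hc w hw)⟩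
  refine ⟨fun v => ?_, ?_, ?_⟩
  · rcases v with _ | _ | _ | _ | _ | i | i
    · refine pair .left (.y ⟨0, h0⟩) (.y ⟨1, h1⟩) nofun nofun ?_
      rintro (_ | _ | _ | _ | _ | i | i) <;> simp [RAdj] <;> omega
    · refine pair .right (.x ⟨1, h1⟩) .z₁ nofun nofun ?_
      rintro (_ | _ | _ | _ | _ | i | i) <;> simp [RAdj] <;> omega
    · refine pair .z₁ (.x ⟨2 * m - 1, hl⟩) (.y ⟨0, h0⟩) nofun nofun ?_
      rintro (_ | _ | _ | _ | _ | i | i) <;> simp [RAdj] <;> omega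
    · refine pair .z₂ (.x ⟨0, h0⟩) (.y ⟨2 * m - 1, hl⟩) nofun nofun ?_
      rintro (_ | _ | _ | _ | _ | i | i) <;> simp [RAdj] <;> omega
    · refine pair .z₃ (.x ⟨2, h2⟩) .z₂ nofun nofun ?_
      rintro (_ | _ | _ | _ | _ | i | i) <;> simp [RAdj] <;> omega
    -- Opposite parity makes y_i dominate y_k, the only y-vertex missed by x_k; an interior k makes
    -- x_k dominate both z₁ and z₂.
    · obtain ⟨k, hk, hki⟩ : ∃ k : Fin (2 * m), (k.val = 1 ∨ k.val = 2) ∧ k.val % 2 ≠ i.val % 2 := by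
        rcases Nat.mod_two_eq_zero_or_one i.val with hi | hi
        · exact ⟨⟨1, h1⟩, .inl rfl, by simp [hi]⟩
        · exact ⟨⟨2, h2⟩, .inr rfl, by simp [hi]⟩
      refine pair (.x i) (.x k) (.y i) (by rintro ⟨⟩; exact hki rfl) nofun ?_
      rintro (_ | _ | _ | _ | _ | j | j) <;> simp [RAdj, Fin.ext_iff] <;> omega
    -- Equal parity makes x_i dominate x_k, the only x-vertex missed by y_k. At an end subscript i,
    -- x_i misses z₁ or z₂, so k must be interior.
    · obtain ⟨k, hk, hki⟩ : ∃ k : Fin (2 * m), k.val % 2 = i.val % 2 ∧ k.val ≠ i.val ∧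
          (i.val = 0 ∨ i.val + 1 = 2 * m → k.val ≠ 0 ∧ k.val + 1 ≠ 2 * m) := by
        by_cases he : i.val = 0
        · exact ⟨⟨2, h2⟩, by simp [he], by simp [he], by simp; omega⟩
        by_cases he' : i.val + 1 = 2 * m
        · exact ⟨⟨1, h1⟩, by simp; omega, by simp; omega, by simp; omega⟩
        rcases Nat.mod_two_eq_zero_or_one i.val with hi | hi
        · exact ⟨⟨0, h0⟩, by simp [hi], by simp; omega, by omega⟩
        · exact ⟨⟨2 * m - 1, hl⟩, by simp [hi]; omega, by simp; omega, by omega⟩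
      refine pair (.y i) (.x i) (.y k) nofun (by rintro ⟨⟩; exact hki.1 rfl) ?_
      rintro (_ | _ | _ | _ | _ | j | j) <;> simp [RAdj, Fin.ext_iff] <;> omega
  · rintro (_ | _ | _ | _ | _ | i | i) <;> simp [RAdj] <;> omega
  · rintro (_ | _ | _ | _ | _ | i | i) <;> simp [RAdj] <;> omega

lemma hasLevels_graphR : HasLevels (graphR.{u} m) 3 := by
  let f : RVertex.{u} m → ℕ
    | .left => 0
    | .x _ => 1
    | .y _ => 2
    | .z₁ => 2
    | .z₂ => 2
    | .z₃ => 3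
    | .right => 3
  refine ⟨f, rfl, rfl, fun a b h => ?_⟩
  replace h := fromRel_RRel_adj.1 h
  rcases a with _ | _ | _ | _ | _ | i | i <;> rcases b with _ | _ | _ | _ | _ | j | j <;>
    first | exact h.elim | simp [f]

lemma walkBound_graphR (hm : 2 ≤ m) : WalkBound (graphR.{u} m) 3 := by
  suffices h : ∀ a b : RVertex.{u} m,
      ∃ p : (SimpleGraph.fromRel (RRel m)).Walk a b, p.length ≤ 3 from h
  have h1 : 1 < 2 * m := by omega
  have h2 : 2 < 2 * m := by omega
  -- Two adjacent hubs see every vertex except Left, which gives distance at most 3 away from Left.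
  have hub : ∀ a : RVertex.{u} m, a ≠ .left →
      RAdj m a (.y ⟨1, h1⟩) ∨ RAdj m a (.y ⟨2, h2⟩) := by
    rintro (_ | _ | _ | _ | _ | i | i) <;> simp [RAdj] <;> omega
  have hy : (SimpleGraph.fromRel (RRel.{u} m)).Adj (.y ⟨1, h1⟩) (.y ⟨2, h2⟩) :=
    fromRel_RRel_adj.2 (by simp [RAdj])
  have hleft : ∀ b : RVertex.{u} m,
      ∃ p : (SimpleGraph.fromRel (RRel m)).Walk .left b, p.length ≤ 3 := by
    have step : ∀ {a b c : RVertex.{u} m} {k : ℕ}, RAdj m a b →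
        (∃ p : (SimpleGraph.fromRel (RRel m)).Walk b c, p.length ≤ k) →
        ∃ p : (SimpleGraph.fromRel (RRel m)).Walk a c, p.length ≤ k + 1 := fun h =>
      exists_walk_cons (fromRel_RRel_adj.2 h)
    have nil : ∀ {a : RVertex.{u} m} {k : ℕ},
        ∃ p : (SimpleGraph.fromRel (RRel m)).Walk a a, p.length ≤ k := ⟨.nil, by simp⟩
    rintro (_ | _ | _ | _ | _ | i | i)
    · exact nil
    · exact step (b := .x ⟨1, h1⟩) trivial
        (step (b := .z₂) (by simp [RAdj]) (step (b := .right) trivial nil))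
    · exact step (b := .x ⟨1, h1⟩) trivial (step (by simp [RAdj]; omega) nil)
    · exact step (b := .x ⟨1, h1⟩) trivial (step (by simp [RAdj]) nil)
    · exact step (b := .x ⟨1, h1⟩) trivial
        (step (b := .z₁) (by simp [RAdj]; omega) (step (b := .z₃) trivial nil))
    · exact step (b := .x i) trivial nil
    · by_cases hi : i.val = 1
      · exact step (b := .x ⟨2, h2⟩) trivial (step (by simp [RAdj]; omega) nil)
      · exact step (b := .x ⟨1, h1⟩) trivial (step (by simp [RAdj]; omega) nil)
  intro a b
  by_cases ha : a = .left
  · subst ha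
    exact hleft b
  by_cases hb : b = .left
  · subst hb
    exact exists_walk_symm (hleft a)
  have ha := hub a ha
  have hb := hub b hb
  simp only [← fromRel_RRel_adj] at ha hb
  rcases ha with ha | ha <;> rcases hb with hb | hb
  · exact exists_walk_cons ha (exists_walk_of_adj hb.symm)
  · exact exists_walk_cons ha (exists_walk_cons hy (exists_walk_of_adj (k := 0) hb.symm))
  · exact exists_walk_cons ha (exists_walk_cons hy.symm (exists_walk_of_adj (k := 0) hb.symm))
  · exact exists_walk_cons ha (exists_walk_of_adj hb.symm)

end R

/-! ### The graph `Q` -/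

section Q

variable {W : Type u} {H : SimpleGraph W}

/-- The vertices of `Q`. -/
abbrev QVertex (W : Type u) : Type u :=
  {v : AVertex W // v ≠ .right} ⊕ {v : AVertex W // v ≠ .left}

namespace QVertex

abbrev left : QVertex W := .inl ⟨.left, nofun⟩
abbrev x₁ (i : W) : QVertex W := .inl ⟨.x i, nofun⟩
abbrev y₁ (i : W) : QVertex W := .inl ⟨.y i, nofun⟩
abbrev x₂ (i : W) : QVertex W := .inr ⟨.x i, nofun⟩
abbrev y₂ (i : W) : QVertex W := .inr ⟨.y i, nofun⟩
abbrev right : QVertex W := .inr ⟨.right, nofun⟩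

lemma cases {P : QVertex W → Prop} (left : P left) (x₁ : ∀ i, P (x₁ i)) (y₁ : ∀ i, P (y₁ i))
    (x₂ : ∀ i, P (x₂ i)) (y₂ : ∀ i, P (y₂ i)) (right : P right) : ∀ v, P v
  | .inl ⟨.left, _⟩ => left
  | .inl ⟨.x i, _⟩ => x₁ i
  | .inl ⟨.y i, _⟩ => y₁ i
  | .inr ⟨.x i, _⟩ => x₂ i
  | .inr ⟨.y i, _⟩ => y₂ i
  | .inr ⟨.right, _⟩ => right
  | .inl ⟨.right, h⟩ => (h rfl).elim
  | .inr ⟨.left, h⟩ => (h rfl).elim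

end QVertex

/-- An explicit description of the adjacency of `Q`. -/
def QRel (H : SimpleGraph W) : QVertex W → QVertex W → Prop
  | .inl ⟨.left, _⟩, .inl ⟨.x _, _⟩ => True
  | .inl ⟨.x _, _⟩, .inl ⟨.left, _⟩ => True
  | .inl ⟨.x i, _⟩, .inl ⟨.x j, _⟩ => H.Adj i j
  | .inl ⟨.x i, _⟩, .inl ⟨.y j, _⟩ => i ≠ j
  | .inl ⟨.y i, _⟩, .inl ⟨.x j, _⟩ => i ≠ j
  | .inl ⟨.y i, _⟩, .inl ⟨.y j, _⟩ => i ≠ j ∧ ¬ H.Adj i j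
  | .inl ⟨.y _, _⟩, .inr ⟨.x _, _⟩ => True
  | .inr ⟨.x _, _⟩, .inl ⟨.y _, _⟩ => True
  | .inr ⟨.x i, _⟩, .inr ⟨.x j, _⟩ => H.Adj i j
  | .inr ⟨.x i, _⟩, .inr ⟨.y j, _⟩ => i ≠ j
  | .inr ⟨.y i, _⟩, .inr ⟨.x j, _⟩ => i ≠ j
  | .inr ⟨.y i, _⟩, .inr ⟨.y j, _⟩ => i ≠ j ∧ ¬ H.Adj i j
  | .inr ⟨.y _, _⟩, .inr ⟨.right, _⟩ => True
  | .inr ⟨.right, _⟩, .inr ⟨.y _, _⟩ => True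
  | _, _ => False

/-- The graph underlying `Q`. -/
def qGraph (H : SimpleGraph W) : SimpleGraph (QVertex W) := (graphQ H).graph

lemma qGraph_adj {a b : QVertex W} : (qGraph H).Adj a b ↔ QRel H a b := by
  change QAdj H a b ↔ _
  rcases a with ⟨_ | _ | i | i, ha⟩ | ⟨_ | _ | i | i, ha⟩ <;>
    rcases b with ⟨_ | _ | j | j, hb⟩ | ⟨_ | _ | j | j, hb⟩ <;>
    simp [QAdj, QRel, graphA, ARel] at ha hb ⊢ <;> grind [SimpleGraph.adj_comm, SimpleGraph.irrefl]

lemma graphQ_left_ne_right : (graphQ H).left ≠ (graphQ H).right := nofun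

lemma QRel.exists_of_x₁ {S : Set (QVertex W)} {i : W} (h : ∃ u ∈ S, QRel H (.x₁ i) u) :
    .left ∈ S ∨ (∃ j, .x₁ j ∈ S ∧ H.Adj i j) ∨ ∃ j, .y₁ j ∈ S ∧ i ≠ j := by
  obtain ⟨u, hu, h⟩ := h
  induction u using QVertex.cases with
  | left => exact .inl hu
  | x₁ j => exact .inr (.inl ⟨j, hu, h⟩)
  | y₁ j => exact .inr (.inr ⟨j, hu, h⟩)
  | x₂ j => exact h.elim
  | y₂ j => exact h.elim
  | right => exact h.elim

lemma QRel.exists_of_y₁ {S : Set (QVertex W)} {i : W} (h : ∃ u ∈ S, QRel H (.y₁ i) u) :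
    (∃ j, .x₁ j ∈ S ∧ i ≠ j) ∨ (∃ j, .y₁ j ∈ S ∧ i ≠ j ∧ ¬ H.Adj i j) ∨ ∃ j, .x₂ j ∈ S := by
  obtain ⟨u, hu, h⟩ := h
  induction u using QVertex.cases with
  | left => exact h.elim
  | x₁ j => exact .inl ⟨j, hu, h⟩
  | y₁ j => exact .inr (.inl ⟨j, hu, h⟩)
  | x₂ j => exact .inr (.inr ⟨j, hu⟩)
  | y₂ j => exact h.elim
  | right => exact h.elim

lemma QRel.exists_of_x₂ {S : Set (QVertex W)} {i : W} (h : ∃ u ∈ S, QRel H (.x₂ i) u) :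
    (∃ j, .y₁ j ∈ S) ∨ (∃ j, .x₂ j ∈ S ∧ H.Adj i j) ∨ ∃ j, .y₂ j ∈ S ∧ i ≠ j := by
  obtain ⟨u, hu, h⟩ := h
  induction u using QVertex.cases with
  | left => exact h.elim
  | x₁ j => exact h.elim
  | y₁ j => exact .inl ⟨j, hu⟩
  | x₂ j => exact .inr (.inl ⟨j, hu, h⟩)
  | y₂ j => exact .inr (.inr ⟨j, hu, h⟩)
  | right => exact h.elim

lemma QRel.exists_of_y₂ {S : Set (QVertex W)} {i : W} (h : ∃ u ∈ S, QRel H (.y₂ i) u) :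
    (∃ j, .x₂ j ∈ S ∧ i ≠ j) ∨ (∃ j, .y₂ j ∈ S ∧ i ≠ j ∧ ¬ H.Adj i j) ∨ .right ∈ S := by
  obtain ⟨u, hu, h⟩ := h
  induction u using QVertex.cases with
  | left => exact h.elim
  | x₁ j => exact h.elim
  | y₁ j => exact h.elim
  | x₂ j => exact .inl ⟨j, hu, h⟩
  | y₂ j => exact .inr (.inl ⟨j, hu, h⟩)
  | right => exact .inr (.inr hu)

lemma qGraph_dominates_left {S : Set (QVertex W)} (h : Dominates (qGraph H) S .left) :
    ∃ i, .x₁ i ∈ S := by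
  obtain ⟨u, hu, h⟩ := h
  rw [qGraph_adj] at h
  induction u using QVertex.cases with
  | x₁ j => exact ⟨j, hu⟩
  | _ => exact h.elim

lemma qGraph_dominates_right {S : Set (QVertex W)} (h : Dominates (qGraph H) S .right) :
    ∃ i, .y₂ i ∈ S := by
  obtain ⟨u, hu, h⟩ := h
  rw [qGraph_adj] at h
  induction u using QVertex.cases with
  | y₂ j => exact ⟨j, hu⟩
  | _ => exact h.elim

/-- The key obstruction is that a pair x_i, y_j in one copy of A cannot by itself dominate that
copy's x- and y-vertices: y_i would require i and j to be non-adjacent in H, while x_j would require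
them to be adjacent. -/
lemma lowerBound_graphQ [Nonempty W] : LowerBound (graphQ H) 3 := by
  refine lowerBound_mk (G := qGraph H) (l := .left) (r := .right) (j := 2) fun S hS => ?_
  replace hS : ∀ v, v ≠ .left → v ≠ .right → ∃ u ∈ S, QRel H v u :=
    fun v hl hr => let ⟨u, hu, h⟩ := hS v hl hr
      ⟨u, hu, qGraph_adj.1 h⟩
  obtain ⟨o⟩ := ‹Nonempty W›
  have hx₁ : ∀ i, _ := fun i => QRel.exists_of_x₁ (hS (.x₁ i) nofun nofun)
  have hy₁ : ∀ i, _ := fun i => QRel.exists_of_y₁ (hS (.y₁ i) nofun nofun)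
  have hx₂ : ∀ i, _ := fun i => QRel.exists_of_x₂ (hS (.x₂ i) nofun nofun)
  have hy₂ : ∀ i, _ := fun i => QRel.exists_of_y₂ (hS (.y₂ i) nofun nofun)
  clear hS
  set T := S \ {.left} with hT
  have hact : .right ∈ S ∨ Dominates (qGraph H) S .right →
      .right ∈ S ∨ ∃ k, .y₂ k ∈ S := Or.imp_right qGraph_dominates_right
  -- if `right` is neither in `S` nor dominated, then `S` contains two of the `x₂`
  have htwo : ¬ (.right ∈ S ∨ Dominates (qGraph H) S .right) →
      ∃ i j, i ≠ j ∧ .x₂ i ∈ S ∧ .x₂ j ∈ S := by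
    intro h
    have hr : .right ∉ S := fun h' => h (.inl h')
    have hn : ∀ k, .y₂ k ∉ S := fun k hk =>
      h (.inr ⟨_, hk, qGraph_adj.2 trivial⟩)
    obtain ⟨i, hi, -⟩ : ∃ i, .x₂ i ∈ S ∧ o ≠ i := by
      simpa [hr, hn] using hy₂ o
    obtain ⟨j, hj, hij⟩ : ∃ j, .x₂ j ∈ S ∧ i ≠ j := by
      simpa [hr, hn] using hy₂ i
    exact ⟨i, j, hij, hi, hj⟩
  -- Without Left, x₁ i needs a neighbour x₁ j or y₁ j. Together with a vertex at the right end this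
  -- makes three, and each combination misses some vertex.
  have hfour : .left ∉ S → ∀ i, .x₁ i ∈ S → (.right ∈ S ∨ ∃ k, .y₂ k ∈ S) → 4 ≤ S.encard := by
    intro hl i hi hc
    by_contra hcard
    rcases hc with hc | ⟨k, hc⟩ <;>
      rcases hx₁ i with h | ⟨j, hj, hij⟩ | ⟨j, hj, hij⟩
    · exact hl h
    · have heq := eq_or_eq_or_eq_of_not_four_le hcard hi hc hj nofun
        (by simpa using hij.ne) nofun
      rcases hx₂ o with ⟨l, hl⟩ | ⟨l, hl, -⟩ | ⟨l, hl, -⟩ <;> simpa using heq _ hl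
    · have heq := eq_or_eq_or_eq_of_not_four_le hcard hi hc hj nofun nofun nofun
      have h₁ : ¬ H.Adj i j := by
        rcases hy₁ i with ⟨l, hl, h⟩ | ⟨l, hl, h⟩ | ⟨l, hl⟩
        · exact (h (by simpa [eq_comm] using heq _ hl)).elim
        · obtain rfl : l = j := by simpa using heq _ hl
          exact h.2
        · simpa using heq _ hl
      have h₂ : H.Adj j i := by
        rcases hx₁ j with h | ⟨l, hl, h⟩ | ⟨l, hl, h⟩
        · exact (hl h).elim
        · obtain rfl : l = i := by simpa using heq _ hl
          exact h
        · exact (h (by simpa [eq_comm] using heq _ hl)).elim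
      exact h₁ h₂.symm
    · exact hl h
    · have heq := eq_or_eq_or_eq_of_not_four_le hcard hi hc hj nofun
        (by simpa using hij.ne) nofun
      rcases hx₂ k with ⟨l, hl⟩ | ⟨l, hl, -⟩ | ⟨l, hl, h⟩
      · simpa using heq _ hl
      · simpa using heq _ hl
      · exact h (by simpa [eq_comm] using heq _ hl)
    · have heq := eq_or_eq_or_eq_of_not_four_le hcard hi hc hj nofun nofun nofun
      rcases hy₂ k with ⟨l, hl, h⟩ | ⟨l, hl, h⟩ | h
      · simpa using heq _ hl
      · exact h.1 (by simpa [eq_comm] using heq _ hl)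
      · simpa using heq _ h
  -- With Left in `S`, the y₁-vertices still need a dominator besides the vertex at the right end,
  -- and these two do not suffice. Without Left and without any x₁-vertex, the x₁-vertices need two
  -- y₁-vertices.
  have hthree : (.right ∈ S ∨ ∃ k, .y₂ k ∈ S) → 3 ≤ T.encard := by
    intro hc
    by_cases hl : .left ∈ S
    · by_contra hcard
      obtain ⟨c, hcS, hc⟩ : ∃ c ∈ T, c = .right ∨ ∃ k, c = .y₂ k := by
        rcases hc with hc | ⟨k, hc⟩
        · exact ⟨.right, ⟨hc, nofun⟩, .inl rfl⟩
        · exact ⟨.y₂ k, ⟨hc, nofun⟩, .inr ⟨k, rfl⟩⟩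
      have hsub : ∀ s ∈ T, s ≠ c → ∀ u ∈ S, u ≠ .left → u = c ∨ u = s := fun s hs hsc u hu hul =>
        eq_or_eq_of_not_three_le hcard hcS hs hsc.symm u ⟨hu, hul⟩
      rcases hy₁ o with ⟨j, hj, -⟩ | ⟨j, hj, -⟩ | ⟨j, hj⟩
      · have heq := hsub _ ⟨hj, nofun⟩ (by rcases hc with rfl | ⟨k, rfl⟩ <;> exact nofun)
        rcases hc with rfl | ⟨k, rfl⟩ <;>
          rcases hy₁ j with ⟨l, hl, h⟩ | ⟨l, hl, h⟩ | ⟨l, hl⟩ <;>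
          first
            | exact h (by simpa [eq_comm] using heq _ hl nofun)
            | simpa using heq _ hl nofun
      · have heq := hsub _ ⟨hj, nofun⟩ (by rcases hc with rfl | ⟨k, rfl⟩ <;> exact nofun)
        rcases hc with rfl | ⟨k, rfl⟩ <;>
          rcases hy₁ j with ⟨l, hl, h⟩ | ⟨l, hl, h⟩ | ⟨l, hl⟩ <;>
          first
            | exact h.1 (by simpa [eq_comm] using heq _ hl nofun)
            | simpa using heq _ hl nofun
      · have heq := hsub _ ⟨hj, nofun⟩ (by rcases hc with rfl | ⟨k, rfl⟩ <;> exact nofun)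
        rcases hc with rfl | ⟨k, rfl⟩
        · rcases hx₂ j with ⟨l, hl⟩ | ⟨l, hl, h⟩ | ⟨l, hl, h⟩
          · simpa using heq _ hl nofun
          · exact h.ne (by simpa [eq_comm] using heq _ hl nofun)
          · simpa using heq _ hl nofun
        · have h₁ : ¬ H.Adj j k := by
            rcases hy₂ j with ⟨l, hl, h⟩ | ⟨l, hl, h⟩ | hl
            · exact (h (by simpa [eq_comm] using heq _ hl nofun)).elim
            · obtain rfl : l = k := by simpa using heq _ hl nofun
              exact h.2
            · simpa using heq _ hl nofun
          have h₂ : H.Adj k j := by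
            rcases hx₂ k with ⟨l, hl⟩ | ⟨l, hl, h⟩ | ⟨l, hl, h⟩
            · simpa using heq _ hl nofun
            · obtain rfl : l = j := by simpa using heq _ hl nofun
              exact h
            · exact (h (by simpa [eq_comm] using heq _ hl nofun)).elim
          exact h₁ h₂.symm
    · have hTS : T = S := Set.sdiff_singleton_eq_self hl
      rw [hTS]
      by_cases hx : ∃ i, .x₁ i ∈ S
      · obtain ⟨i, hi⟩ := hx
        exact le_trans (by norm_num) (hfour hl i hi hc)
      · push Not at hx
        obtain ⟨i, hi, -⟩ : ∃ i, .y₁ i ∈ S ∧ o ≠ i := by simpa [hl, hx] using hx₁ o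
        obtain ⟨j, hj, hij⟩ : ∃ j, .y₁ j ∈ S ∧ i ≠ j := by simpa [hl, hx] using hx₁ i
        rcases hc with hc | ⟨k, hc⟩
        · exact three_le_encard hi hj hc (by simpa using hij) nofun nofun
        · exact three_le_encard hi hj hc (by simpa using hij) nofun nofun
  refine ⟨?_, fun h => le_trans (by norm_num) (hthree (hact h)), fun hl hd => ?_⟩
  · by_cases h : .right ∈ S ∨ Dominates (qGraph H) S .right
    · exact le_trans (by norm_num) (hthree (hact h))
    · obtain ⟨i, j, hij, hi, hj⟩ := htwo h
      exact two_le_encard (S := T) ⟨hi, nofun⟩ ⟨hj, nofun⟩ (by simpa using hij)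
  · obtain ⟨k, hk⟩ := qGraph_dominates_left hd
    refine ⟨?_, fun h => le_trans (by norm_num) (hfour hl k hk (hact h))⟩
    by_cases h : .right ∈ S ∨ Dominates (qGraph H) S .right
    · exact le_trans (by norm_num) (hfour hl k hk (hact h))
    · obtain ⟨i, j, hij, hi, hj⟩ := htwo h
      exact le_trans (by norm_num) (three_le_encard hk hi hj nofun nofun (by simpa using hij))

lemma encard_quadruple_le {V : Type u} (a b c d : V) : ({a, b, c, d} : Set V).encard ≤ 4 :=
  (Set.encard_insert_le _ _).trans
    ((add_le_add (encard_triple_le b c d) le_rfl).trans (by norm_num))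

lemma dominates_quadruple {V : Type u} {G : SimpleGraph V} {a b c d w : V} :
    Dominates G {a, b, c, d} w ↔ G.Adj w a ∨ G.Adj w b ∨ G.Adj w c ∨ G.Adj w d := by
  simp [Dominates]

/-- To delete a vertex of one copy of A, one marked vertex takes care of the outer layer of the
other copy, and two vertices do the rest. The marked vertex that is used stays undominated, hence
the exemptions. -/
lemma upperBound_graphQ [Nonempty W] (hH : ∃ p q, ∀ w, H.Adj w p ∨ H.Adj w q)
    (hHc : ∃ p q, ∀ w, Hᶜ.Adj w p ∨ Hᶜ.Adj w q) : UpperBound True True (graphQ H) 3 := by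
  obtain ⟨o⟩ := ‹Nonempty W›
  obtain ⟨p, q, hpq⟩ := hH
  obtain ⟨p', q', hpq'⟩ := hHc
  simp only [SimpleGraph.compl_adj] at hpq'
  have hadj : ∀ i, ∃ k, H.Adj i k := fun i => (hpq i).elim (fun h => ⟨_, h⟩) fun h => ⟨_, h⟩
  have hnadj : ∀ i, ∃ k, i ≠ k ∧ ¬ H.Adj i k := fun i =>
    (hpq' i).elim (fun h => ⟨_, h⟩) fun h => ⟨_, h⟩
  have triple : ∀ (v a b c : QVertex W), v ≠ a → v ≠ b → v ≠ c →
      (∀ w, w ≠ v → (QRel H w a ∨ QRel H w b ∨ QRel H w c) ∨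
        w = a ∧ (w = .left ∨ w = .right)) →
      ∃ S : Set (QVertex W), v ∉ S ∧ S.encard ≤ (3 : ℕ) ∧ ∀ w, w ≠ v →
        Dominates (qGraph H) S w ∨ w ∈ S ∧ (True ∧ w = .left ∨ True ∧ w = .right) :=
    fun v a b c ha hb hc h =>
    ⟨{a, b, c}, by simp [ha, hb, hc], encard_triple_le a b c, fun w hw => by
      simp only [dominates_triple, qGraph_adj, true_and]
      exact (h w hw).imp_right fun h => ⟨.inl h.1, h.2⟩⟩
  refine upperBound_mk (G := qGraph H) (l := .left) (r := .right) (fun v => ?_) ?_ ?_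
  · induction v using QVertex.cases with
    | left =>
      refine triple _ .right (.y₁ p') (.y₁ q') nofun nofun nofun fun w hw => ?_
      -- No vertex is its own neighbour, so p' ≠ q'; thus every x₁-vertex sees one of the two
      -- y₁-vertices.
      have := hpq' p'
      induction w using QVertex.cases <;> simp [QRel] at hw ⊢ <;> grind
    | right =>
      refine triple _ .left (.x₂ p) (.x₂ q) nofun nofun nofun fun w hw => ?_
      have := hpq p
      induction w using QVertex.cases <;> simp [QRel] at hw ⊢ <;> grind [SimpleGraph.irrefl]
    | x₁ i =>
      -- The pair y₁ i, x₁ k misses only x₁ i within its copy: y₁ k, not seen by x₁ k, is seen by y₁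
      -- i because i and k are non-adjacent in H. Deleting a y-vertex uses an H-edge instead.
      obtain ⟨k, hk, hik⟩ := hnadj i
      refine triple _ .right (.y₁ i) (.x₁ k) nofun nofun (by simpa using hk) fun w hw => ?_
      induction w using QVertex.cases <;> simp [QRel] at hw ⊢ <;> grind [SimpleGraph.adj_comm]
    | y₁ i =>
      obtain ⟨k, hik⟩ := hadj i
      refine triple _ .right (.x₁ i) (.y₁ k) nofun nofun (by simpa using hik.ne) fun w hw => ?_
      induction w using QVertex.cases <;> simp [QRel] at hw ⊢ <;>
        grind [SimpleGraph.adj_comm, SimpleGraph.irrefl]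
    | x₂ i =>
      obtain ⟨k, hk, hik⟩ := hnadj i
      refine triple _ .left (.y₂ i) (.x₂ k) nofun nofun (by simpa using hk) fun w hw => ?_
      induction w using QVertex.cases <;> simp [QRel] at hw ⊢ <;> grind [SimpleGraph.adj_comm]
    | y₂ i =>
      obtain ⟨k, hik⟩ := hadj i
      refine triple _ .left (.x₂ i) (.y₂ k) nofun nofun (by simpa using hik.ne) fun w hw => ?_
      induction w using QVertex.cases <;> simp [QRel] at hw ⊢ <;>
        grind [SimpleGraph.adj_comm, SimpleGraph.irrefl]
  · obtain ⟨k, hk, hok⟩ := hnadj o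
    refine ⟨{.left, .right, .x₁ o, .y₁ k}, by simp, (encard_quadruple_le _ _ _ _).trans
      (by norm_num), fun w => ?_⟩
    simp only [dominates_quadruple, qGraph_adj]
    induction w using QVertex.cases <;> (simp [QRel]; try grind [SimpleGraph.adj_comm])
  · obtain ⟨k, hok⟩ := hadj o
    refine ⟨{.left, .right, .x₂ o, .y₂ k}, by simp, (encard_quadruple_le _ _ _ _).trans
      (by norm_num), fun w => ?_⟩
    simp only [dominates_quadruple, qGraph_adj]
    induction w using QVertex.cases <;> simp [QRel] <;>
      grind [SimpleGraph.adj_comm, SimpleGraph.irrefl]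

lemma hasLevels_graphQ : HasLevels (graphQ H) 5 := by
  let f : QVertex W → ℕ
    | .inl ⟨.left, _⟩ => 0
    | .inl ⟨.x _, _⟩ => 1
    | .inl ⟨.y _, _⟩ => 2
    | .inr ⟨.x _, _⟩ => 3
    | .inr ⟨.y _, _⟩ => 4
    | .inr ⟨.right, _⟩ => 5
  suffices h : ∀ a b, (qGraph H).Adj a b → f b ≤ f a + 1 from ⟨f, rfl, rfl, h⟩
  intro a b h
  rw [qGraph_adj] at h
  induction a using QVertex.cases <;> induction b using QVertex.cases <;>
    first | exact h.elim | simp [f]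

/-- Opposite halves are joined layer by layer, a second index bypassing the missing edges x_i y_i.
Within a half, walks meet at x₂ o or y₁ o, the marked vertex being treated apart. -/
lemma walkBound_graphQ [Nontrivial W] : WalkBound (graphQ H) 5 := by
  suffices h : ∀ a b, ∃ p : (qGraph H).Walk a b, p.length ≤ 5 from h
  obtain ⟨o, -, -⟩ := exists_pair_ne W
  have step : ∀ {a b c : QVertex W} {k : ℕ}, QRel H a b →
      (∃ p : (qGraph H).Walk b c, p.length ≤ k) → ∃ p : (qGraph H).Walk a c, p.length ≤ k + 1 :=
    fun h => exists_walk_cons (qGraph_adj.2 h)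
  have nil : ∀ {a : QVertex W} {k : ℕ}, ∃ p : (qGraph H).Walk a a, p.length ≤ k :=
    ⟨.nil, by simp⟩
  have hx₁x₂ : ∀ i j, ∃ p : (qGraph H).Walk (.x₁ i) (.x₂ j), p.length ≤ 2 := fun i j =>
    let ⟨k, hk⟩ := exists_ne i
    step (b := .y₁ k) hk.symm (step (b := .x₂ j) trivial nil)
  have hy₂y₁ : ∀ i j, ∃ p : (qGraph H).Walk (.y₂ i) (.y₁ j), p.length ≤ 2 := fun i j =>
    let ⟨k, hk⟩ := exists_ne i
    step (b := .x₂ k) hk.symm (step (b := .y₁ j) trivial nil)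
  have hfirst : ∀ a j, ∃ p : (qGraph H).Walk (.inl a) (.x₂ j), p.length ≤ 3 := by
    rintro ⟨_ | _ | i | i, ha⟩ j
    · exact step (b := .x₁ o) trivial (hx₁x₂ o j)
    · exact (ha rfl).elim
    · exact exists_walk_append (hx₁x₂ i j) (nil (k := 0)) (by norm_num)
    · exact step (b := .x₂ j) trivial nil
  have hsecond : ∀ b, ∃ j, ∃ p : (qGraph H).Walk (.x₂ j) (.inr b), p.length ≤ 2 := by
    rintro ⟨_ | _ | i | i, hb⟩
    · exact (hb rfl).elim
    · obtain ⟨k, hk⟩ := exists_ne o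
      exact ⟨k, step (b := .y₂ o) hk (step (b := .right) trivial nil)⟩
    · exact ⟨i, nil⟩
    · obtain ⟨k, hk⟩ := exists_ne i
      exact ⟨k, step (b := .y₂ i) hk nil⟩
  have hcross : ∀ a b, ∃ p : (qGraph H).Walk (.inl a) (.inr b), p.length ≤ 5 := fun a b =>
    let ⟨j, hj⟩ := hsecond b
    exists_walk_append (hfirst a j) hj (by norm_num)
  have hleft : ∀ a, ∃ p : (qGraph H).Walk .left (.inl a), p.length ≤ 5 := by
    rintro ⟨_ | _ | i | i, ha⟩
    · exact nil
    · exact (ha rfl).elim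
    · exact step (b := .x₁ i) trivial nil
    · obtain ⟨k, hk⟩ := exists_ne i
      exact step (b := .x₁ k) trivial (step (b := .y₁ i) hk nil)
  have hright : ∀ b, ∃ p : (qGraph H).Walk .right (.inr b), p.length ≤ 5 := by
    rintro ⟨_ | _ | i | i, hb⟩
    · exact (hb rfl).elim
    · exact nil
    · obtain ⟨k, hk⟩ := exists_ne i
      exact step (b := .y₂ k) trivial (step (b := .x₂ i) hk nil)
    · exact step (b := .y₂ i) trivial nil
  have hfirst' : ∀ a, Sum.inl a ≠ (.left : QVertex W) →
      ∃ p : (qGraph H).Walk (.inl a) (.x₂ o), p.length ≤ 2 := by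
    rintro ⟨_ | _ | i | i, ha⟩ hl
    · exact (hl rfl).elim
    · exact (ha rfl).elim
    · exact hx₁x₂ i o
    · exact step (b := .x₂ o) trivial nil
  have hsecond' : ∀ b, Sum.inr b ≠ (.right : QVertex W) →
      ∃ p : (qGraph H).Walk (.inr b) (.y₁ o), p.length ≤ 2 := by
    rintro ⟨_ | _ | i | i, hb⟩ hr
    · exact (hb rfl).elim
    · exact (hr rfl).elim
    · exact step (b := .y₁ o) trivial nil
    · exact hy₂y₁ i o
  rintro (a | a) (b | b)
  · by_cases ha : Sum.inl a = (.left : QVertex W)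
    · rw [ha]
      exact hleft b
    by_cases hb : Sum.inl b = (.left : QVertex W)
    · rw [hb]
      exact exists_walk_symm (hleft a)
    exact exists_walk_append (hfirst' a ha) (exists_walk_symm (hfirst' b hb)) (by norm_num)
  · exact hcross a b
  · exact exists_walk_symm (hcross b a)
  · by_cases ha : Sum.inr a = (.right : QVertex W)
    · rw [ha]
      exact hright b
    by_cases hb : Sum.inr b = (.right : QVertex W)
    · rw [hb]
      exact exists_walk_symm (hright a)
    exact exists_walk_append (hsecond' a ha) (exists_walk_symm (hsecond' b hb)) (by norm_num)

end Q

lemma exists_pair_of_totalDominationNumber_eq_two {V : Type u} {G : SimpleGraph V}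
    (h : totalDominationNumber G = 2) : ∃ p q, ∀ w, G.Adj w p ∨ G.Adj w q := by
  -- An empty infimum would be `⊤`; over a nonempty family the infimum in `ℕ∞` is attained.
  have hne : Nonempty {S : Set V // IsTotalDominating G S} := by
    by_contra hne
    rw [not_nonempty_iff] at hne
    rw [totalDominationNumber, iInf_of_empty] at h
    exact absurd h (by simp)
  obtain ⟨⟨S, hS⟩, hcard⟩ := ENat.exists_eq_iInf
    fun S : {S : Set V // IsTotalDominating G S} => S.1.encard
  obtain ⟨p, q, -, rfl⟩ := Set.encard_eq_two.1 (hcard.trans h)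
  exact ⟨p, q, fun w => dominates_pair.1 (hS w)⟩

/-! ### Powers of a pointed graph -/

namespace PointedGraph

lemma dotPow_left_ne_right {X : PointedGraph.{u}} (h : X.left ≠ X.right) :
    ∀ n, (X.dotPow (n + 1)).left ≠ (X.dotPow (n + 1)).right
  | 0 => h
  | n + 1 => dot_left_ne_right (dotPow_left_ne_right h n)

lemma LowerBound.dotPow {X : PointedGraph.{u}} {j : ℕ} (h : LowerBound X j)
    (hne : X.left ≠ X.right) : ∀ n, LowerBound (X.dotPow n) (j * n)
  | 0 => lowerBound_point
  | 1 => by rwa [mul_one]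
  | n + 2 => (h.dotPow hne (n + 1)).dot h (dotPow_left_ne_right hne n)
      fun h' => (hne h'.symm).elim

lemma UpperBound.dotPow {X : PointedGraph.{u}} {j : ℕ} (h : UpperBound True True X j) :
    ∀ n, UpperBound True True (X.dotPow n) (j * n)
  | 0 => upperBound_point
  | 1 => by rwa [mul_one]
  | n + 2 => (h.dotPow (n + 1)).dot h

lemma WalkBound.dotPow {X : PointedGraph.{u}} {ℓ : ℕ} (h : WalkBound X ℓ) :
    ∀ n, WalkBound (X.dotPow n) (ℓ * n)
  | 0 => walkBound_point
  | 1 => by rwa [mul_one]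
  | n + 2 => (h.dotPow (n + 1)).dot h

lemma HasLevels.dotPow {X : PointedGraph.{u}} {ℓ : ℕ} (h : HasLevels X ℓ) :
    ∀ n, HasLevels (X.dotPow n) (ℓ * n)
  | 0 => hasLevels_point
  | 1 => by rwa [mul_one]
  | n + 2 => (h.dotPow (n + 1)).dot h

end PointedGraph

variable {W : Type u} {H : SimpleGraph W}

/-! ### The graph `R • Q^(n) • R • R` -/

lemma lowerBound_graphRQRR [Nonempty W] (m n : ℕ) :
    LowerBound (graphRQRR H m n) (2 + 3 * n + 2 + 2) := by
  have hR := graphR_left_ne_right.{u} (m := m)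
  refine (((lowerBound_graphR.dot
    (lowerBound_graphQ.dotPow graphQ_left_ne_right n) hR fun h => ?_).dot
    lowerBound_graphR (dot_left_ne_right hR) fun h => (hR h.symm).elim).dot
    lowerBound_graphR (dot_left_ne_right (dot_left_ne_right hR)) fun h => (hR h.symm).elim)
  cases n with
  | zero => rfl
  | succ n => exact (dotPow_left_ne_right graphQ_left_ne_right n h.symm).elim

lemma upperBound_graphRQRR [Nonempty W] (hH : ∃ p q, ∀ w, H.Adj w p ∨ H.Adj w q)
    (hHc : ∃ p q, ∀ w, Hᶜ.Adj w p ∨ Hᶜ.Adj w q) {m : ℕ} (hm : 2 ≤ m) (n : ℕ) :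
    UpperBound False False (graphRQRR H m n) (2 + 3 * n + 2 + 2) := by
  -- R needs no exemption, so it accepts any flags: `True` next to another block, `False` at the
  -- outer ends.
  have hR : ∀ el er, UpperBound el er (graphR.{u} m) 2 := fun el er =>
    (upperBound_graphR hm).mono False.elim False.elim
  exact (((hR False True).dot ((upperBound_graphQ hH hHc).dotPow n)).dot
    (hR True True)).dot (hR True False)

lemma diam_graphRQRR [Nontrivial W] {m : ℕ} (hm : 2 ≤ m) (n : ℕ) :
    (graphRQRR H m n).graph.diam = 3 + 5 * n + 3 + 3 :=
  diam_eq
    ((((walkBound_graphR hm).dot (walkBound_graphQ.dotPow n)).dot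
      (walkBound_graphR hm)).dot (walkBound_graphR hm))
    (((hasLevels_graphR.dot (hasLevels_graphQ.dotPow n)).dot
      hasLevels_graphR).dot hasLevels_graphR)

end TotalDomination

theorem mainTheorem7 {W : Type*} [Fintype W] (H : SimpleGraph W)
    (hW : 4 ≤ Fintype.card W)
    (hH : TotalDomination.totalDominationNumber H = 2)
    (hHc : TotalDomination.totalDominationNumber Hᶜ = 2)
    (m : ℕ) (hm : 2 ≤ m) (n : ℕ) :
    TotalDomination.IsKVertexCritical (TotalDomination.graphRQRR H m n).graph (3 * n + 7) ∧
      (TotalDomination.graphRQRR H m n).graph.diam = 5 * n + 9 := by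
  have : Nontrivial W := Fintype.one_lt_card_iff_nontrivial.1 (by omega)
  have hpH := TotalDomination.exists_pair_of_totalDominationNumber_eq_two hH
  have hpHc := TotalDomination.exists_pair_of_totalDominationNumber_eq_two hHc
  constructor
  · have h := TotalDomination.isKVertexCritical_of_bounds
      (TotalDomination.lowerBound_graphRQRR (H := H) m n)
      (TotalDomination.upperBound_graphRQRR hpH hpHc hm n)
    rwa [show 2 + 3 * n + 2 + 2 + 1 = 3 * n + 7 by ring] at h
  · rw [TotalDomination.diam_graphRQRR hm n]
    ring
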